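/- Let $(K,\partial)$ be a differential field of characteristic $0$, and let $G$ be a linear differential algebraic group over $K$ with coordinate ring $A=K\{G\}$. That is, $A$ is a finitely $\partial$-generated commutative differential Hopf algebra over $K$: a commutative Hopf algebra with a derivation $\partial$ extending that of $K$, such that the comultiplication $\Delta$, the counit $\varepsilon$ and the coinverse $S$ commute with $\partial$ (where $\partial(a\otimes b)=\partial a\otimes b+a\otimes\partial b$), and $A$ is generated as a $K$-algebra by finitely many elements and their derivatives; $G$ is the functor $B\mapsto\mathrm{Hom}_{\partial\text{-}K\text{-alg}}(A,B)$. A differential representation of $G$ is a finite-dimensional $K$-space $V$ with an $A$-comodule structure $\rho_V:V\to V\otimes A$. Representations have the usual tensor products $V\otimes W$, duals $V^*$ (with $(gu)(v)=u(g^{-1}v)$) and trivial object $\mathbf 1=K$, and the prolongation $V^{(1)}=K[\partial]_{\le1}\otimes_K V$, whose coaction extends $\rho_V$ and satisfies $\rho(\partial v)=\sum_i(\partial v_i\otimes a_i+v_i\otimes\partial a_i)$ if $\rho_V(v)=\sum_i v_i\otimes a_i$. For $u\in V^*$ let $F(u)\in(V^{(1)})^*$ be given by $F(u)(v)=u(v)$,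 $F(u)(\partial v)=\partial(u(v))$. For $v\in V$, $u\in V^*$ let $\psi_V(v\otimes u)=(u\otimes\mathrm{id})(\rho_V(v))\in A$ be the matrix coefficient $g\mapsto u(gv)$. Let $\mathcal A$ be the quotient of the vector space $\bigoplus_V V\otimes V^*$, over all differential representations $V$ of $G$, by the span of all elements $v\otimes\varphi^*(t)-\varphi(v)\otimes t$ with $\varphi:V\to W$ a morphism of representations, $v\in V$, $t\in W^*$. Write $a_V(v\otimes u)$ for the class of $v\otimes u\in V\otimes V^*$. Then $\mathcal A$ is a commutative differential $K$-algebra with product $a_V(v\otimes u)\,a_W(w\otimes t)=a_{V\otimes W}((v\otimes w)\otimes(u\otimes t))$, unit $a_{\mathbf 1}(1\otimes\mathrm{id})$ and derivation $\partial(a_V(v\otimes u))=a_{V^{(1)}}(\partial v\otimes F(u))$. Proposition. There are well-defined homomorphisms of differential $K$-algebras $\tilde\Delta:\mathcal A\to\mathcal A\otimes\mathcal A$, $\tilde\varepsilon:\mathcal A\to K$, $\tilde S:\mathcal A\to\mathcal A$ such that for every representation $V$, all $v\in V$, $u\in V^*$ and every basis $(v_i)$ of $V$ with dual basis $(u_i)$,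 $$\tilde\Delta(a_V(v\otimes u))=\sum_i a_V(v_i\otimes u)\otimes a_V(v\otimes u_i),\qquad \tilde\varepsilon(a_V(v\otimes u))=u(v),\qquad \tilde S(a_V(v\otimes u))=a_{V^*}(u\otimes v),$$ where $v$ is viewed in $V^{**}$. With them $\mathcal A$ is a (finitely $\partial$-generated) differential Hopf algebra over $K$, and there is an isomorphism of differential Hopf algebras $\Phi:\mathcal A\to A$ (a $K$-algebra isomorphism commuting with $\partial$, the comultiplications, the counits and the coinverses) with $\Phi(a_V(v\otimes u))=\psi_V(v\otimes u)$ for all $V$, $v$, $u$. -/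

import Mathlib

open scoped TensorProduct Differential

universe u v w

noncomputable section

namespace DiffTannaka

/-! ### Differential algebras and differential Hopf algebras -/

section TensorDifferential

variable (K : Type u) [Field K] [Differential K]
  (B : Type v) [CommRing B] [Algebra K B] [Differential B] [DifferentialAlgebra K B]
  (C : Type w) [CommRing C] [Algebra K C] [Differential C] [DifferentialAlgebra K C]

lemma deriv_smul {K : Type u} [Field K] [Differential K]
    {B : Type v} [CommRing B] [Algebra K B] [Differential B] [DifferentialAlgebra K B]
    (c : K) (b : B) : (c • b)′ = c • b′ + c′ • b := by
  rw [Algebra.smul_def, Derivation.leibniz, DifferentialAlgebra.deriv_algebraMap]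
  simp [Algebra.smul_def, mul_comm]

/-- The additive map `b ⊗ c ↦ b′ ⊗ c + b ⊗ c′` on a tensor product of differential algebras. -/
def tensorDeriv : B ⊗[K] C →+ B ⊗[K] C :=
  TensorProduct.liftAddHom
    (AddMonoidHom.mk' (fun b => AddMonoidHom.mk' (fun c => b′ ⊗ₜ[K] c + b ⊗ₜ[K] c′)
        (fun x y => by simp only [map_add, TensorProduct.tmul_add]; abel))
      (fun x y => by
        ext c
        simp only [map_add, TensorProduct.add_tmul, AddMonoidHom.mk'_apply, AddMonoidHom.add_apply]
        abel))
    (fun r m n => by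
      simp only [AddMonoidHom.mk'_apply, deriv_smul, TensorProduct.add_tmul,
        TensorProduct.tmul_add, TensorProduct.smul_tmul]
      abel)

@[simp] lemma tensorDeriv_tmul (b : B) (c : C) :
    tensorDeriv K B C (b ⊗ₜ c) = b′ ⊗ₜ[K] c + b ⊗ₜ[K] c′ := rfl

lemma tensorDeriv_mul (x y : B ⊗[K] C) :
    tensorDeriv K B C (x * y) = x * tensorDeriv K B C y + y * tensorDeriv K B C x := by
  induction x with
  | zero => simp
  | add x₁ x₂ h₁ h₂ => simp only [add_mul, map_add, mul_add, h₁, h₂]; abel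
  | tmul b c =>
    induction y with
    | zero => simp
    | add y₁ y₂ h₁ h₂ => simp only [add_mul, map_add, mul_add, h₁, h₂]; abel
    | tmul b' c' =>
      simp only [Algebra.TensorProduct.tmul_mul_tmul, tensorDeriv_tmul, Derivation.leibniz,
        smul_eq_mul, TensorProduct.add_tmul, TensorProduct.tmul_add, mul_add,
        mul_comm b' b, mul_comm c' c]
      abel

/-- The tensor product of two differential `K`-algebras is a differential ring, with
`(b ⊗ c)′ = b′ ⊗ c + b ⊗ c′`. -/
instance tensorDifferential : Differential (B ⊗[K] C) where
  deriv := Derivation.mk' (tensorDeriv K B C).toIntLinearMap (fun x y => tensorDeriv_mul K B C x y)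

@[simp] lemma deriv_tmul (b : B) (c : C) :
    (b ⊗ₜ[K] c)′ = b′ ⊗ₜ[K] c + b ⊗ₜ[K] c′ := rfl

end TensorDifferential

/-- A differential `K`-algebra `B` with comultiplication `Δ`, counit `ε` and coinverse `S` is a
differential Hopf algebra: `Δ`, `ε`, `S` are homomorphisms of differential `K`-algebras satisfying
the (two-sided) Hopf algebra axioms. -/
structure IsDifferentialHopf {K : Type u} {B : Type v} [Field K] [Differential K] [CommRing B]
    [Algebra K B] [Differential B] [DifferentialAlgebra K B]
    (Δ : B →ₐ[K] B ⊗[K] B) (ε : B →ₐ[K] K) (S : B →ₐ[K] B) : Prop where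
  deriv_comul : ∀ x, (Δ x)′ = Δ (x′)
  deriv_counit : ∀ x, (ε x)′ = ε (x′)
  deriv_antipode : ∀ x, (S x)′ = S (x′)
  coassoc : ∀ x, TensorProduct.assoc K B B B (Δ.toLinearMap.rTensor B (Δ x)) =
    Δ.toLinearMap.lTensor B (Δ x)
  counit_left : ∀ x, ε.toLinearMap.rTensor B (Δ x) = 1 ⊗ₜ[K] x
  counit_right : ∀ x, ε.toLinearMap.lTensor B (Δ x) = x ⊗ₜ[K] 1
  antipode_left : ∀ x, LinearMap.mul' K B (S.toLinearMap.rTensor B (Δ x)) = algebraMap K B (ε x)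
  antipode_right : ∀ x, LinearMap.mul' K B (S.toLinearMap.lTensor B (Δ x)) = algebraMap K B (ε x)

/-- The Hopf algebra `A`, which is also a differential `K`-algebra, is a differential Hopf
algebra. -/
class DifferentialHopfAlgebra (K : Type u) (A : Type v) [Field K] [Differential K] [CommRing A]
    [HopfAlgebra K A] [Differential A] [DifferentialAlgebra K A] : Prop where
  isDifferentialHopf : IsDifferentialHopf (Bialgebra.comulAlgHom K A) (Bialgebra.counitAlgHom K A)
    (HopfAlgebra.antipodeAlgHom K A)

/-- `A` is finitely `∂`-generated: some finite set together with all its derivatives generates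
`A` as a `K`-algebra. -/
def FinitelyDiffGenerated (K : Type u) (A : Type v) [Field K] [CommRing A] [Algebra K A]
    [Differential A] : Prop :=
  ∃ s : Finset A, Algebra.adjoin K {x : A | ∃ a ∈ s, ∃ n : ℕ, x = (fun y : A => y′)^[n] a} = ⊤

/-! ### Differential representations

The linear differential algebraic group `G` is the group functor `B ↦ Hom_∂(A, B)` represented by
the differential Hopf algebra `A = K{G}`; its differential representations are the
finite-dimensional `A`-comodules. -/

/-- A differential representation of `G`: a finite-dimensional `K`-vector space `V` with a
coaction `ρ : V → V ⊗ A`. -/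
structure DiffRep (K : Type u) (A : Type v) [Field K] [CommRing A] [HopfAlgebra K A] where
  carrier : Type u
  [addCommGroup : AddCommGroup carrier]
  [module : Module K carrier]
  [finite : Module.Finite K carrier]
  /-- the coaction -/
  ρ : carrier →ₗ[K] carrier ⊗[K] A
  coassoc : (TensorProduct.assoc K carrier A A).toLinearMap ∘ₗ ρ.rTensor A ∘ₗ ρ =
    (Coalgebra.comul (R := K) (A := A)).lTensor carrier ∘ₗ ρ
  counit : (Coalgebra.counit (R := K) (A := A)).lTensor carrier ∘ₗ ρ =
    (TensorProduct.mk K carrier K).flip 1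

attribute [instance] DiffRep.addCommGroup DiffRep.module DiffRep.finite

instance (K : Type u) (A : Type v) [Field K] [CommRing A] [HopfAlgebra K A] :
    CoeSort (DiffRep K A) (Type u) := ⟨DiffRep.carrier⟩

/-- `G`-equivariant linear maps, that is, morphisms of comodules. -/
structure DiffRep.Hom {K : Type u} {A : Type v} [Field K] [CommRing A] [HopfAlgebra K A]
    (V W : DiffRep K A) where
  toLin : V →ₗ[K] W
  equivariant : W.ρ ∘ₗ toLin = toLin.rTensor A ∘ₗ V.ρ

section Matrix

variable {K : Type u} {A : Type v} [Field K] [CommRing A] [HopfAlgebra K A]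

/-- The contraction `V ⊗ A → A` with `u ∈ V*`. -/
def contract {V : Type w} [AddCommGroup V] [Module K V] (u : Module.Dual K V) :
    V ⊗[K] A →ₗ[K] A :=
  (TensorProduct.lid K A).toLinearMap ∘ₗ u.rTensor A

@[simp] lemma contract_tmul {V : Type w} [AddCommGroup V] [Module K V] (u : Module.Dual K V)
    (x : V) (a : A) : contract u (x ⊗ₜ[K] a) = u x • a := by
  simp [contract]

/-- The matrix coefficient `ψ_V(v ⊗ u) = (u ⊗ id) (ρ v) ∈ A`, that is, the function
`g ↦ u (r_V(g) v)` on `G`; see `psi_eval`. -/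
def psi (V : DiffRep K A) (x : V) (f : Module.Dual K V) : A := contract f (V.ρ x)

/-- For a point `g : A → B` of `G`, which acts by `r_V(g) v = (id ⊗ g) (ρ v) ∈ V ⊗ B`, the value of
`ψ_V(v ⊗ u)` at `g` is `u (r_V(g) v)`. -/
lemma psi_eval (V : DiffRep K A) {B : Type w} [CommRing B] [Algebra K B] (g : A →ₐ[K] B)
    (x : V) (f : Module.Dual K V) :
    g (psi V x f) =
      TensorProduct.lid K B (f.rTensor B (g.toLinearMap.lTensor V.carrier (V.ρ x))) := by
  unfold psi
  induction V.ρ x with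
  | zero => simp
  | add y z hy hz => simp only [map_add, hy, hz]
  | tmul y a => simp

lemma eq_of_contract {V : Type w} [AddCommGroup V] [Module K V] {ι : Type*} [Fintype ι]
    (b : Module.Basis ι K V) (x : V ⊗[K] A) :
    x = ∑ i, b i ⊗ₜ[K] contract (b.coord i) x := by
  induction x with
  | zero => simp
  | add y z hy hz =>
    conv_lhs => rw [hy, hz]
    simp only [map_add, TensorProduct.tmul_add, Finset.sum_add_distrib]
  | tmul y a =>
    conv_lhs => rw [← b.sum_repr y, TensorProduct.sum_tmul]
    exact Finset.sum_congr rfl fun i _ => by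
      rw [contract_tmul, TensorProduct.smul_tmul, Module.Basis.coord_apply]

lemma rho_basis (V : DiffRep K A) {ι : Type*} [Fintype ι] (b : Module.Basis ι K V) (x : V) :
    V.ρ x = ∑ i, b i ⊗ₜ[K] psi V x (b.coord i) :=
  eq_of_contract b (V.ρ x)

lemma comul_psi (V : DiffRep K A) {ι : Type*} [Fintype ι] (b : Module.Basis ι K V) (x : V)
    (f : Module.Dual K V) :
    Coalgebra.comul (R := K) (psi V x f) = ∑ r, psi V (b r) f ⊗ₜ[K] psi V x (b.coord r) := by
  have h := LinearMap.congr_fun V.coassoc x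
  have h2 := congrArg (contract (A := A ⊗[K] A) f) h
  have h3 : ∀ z : V ⊗[K] A, contract f ((Coalgebra.comul (R := K) (A := A)).lTensor V.carrier z) =
      Coalgebra.comul (R := K) (contract f z) := by
    intro z
    induction z with
    | zero => simp
    | add y z hy hz => simp only [map_add, hy, hz]
    | tmul y a => simp
  have h4 : ∀ (z : V ⊗[K] A) (a : A), contract f (TensorProduct.assoc K V A A (z ⊗ₜ a)) =
      contract f z ⊗ₜ[K] a := by
    intro z a
    induction z with
    | zero => simp
    | add y z hy hz => simp only [map_add, TensorProduct.add_tmul, hy, hz]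
    | tmul y a => simp [TensorProduct.smul_tmul']
  simp only [LinearMap.comp_apply, h3] at h2
  unfold psi
  rw [← h2]
  conv_lhs => rw [rho_basis V b x]
  simp only [map_sum, LinearMap.rTensor_tmul, LinearEquiv.coe_coe, h4, psi]

lemma counit_psi (V : DiffRep K A) (x : V) (f : Module.Dual K V) :
    Coalgebra.counit (R := K) (psi V x f) = f x := by
  have h := LinearMap.congr_fun V.counit x
  have h2 := congrArg (contract (A := K) f) h
  have h3 : ∀ z : V ⊗[K] A, contract f ((Coalgebra.counit (R := K) (A := A)).lTensor V.carrier z) =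
      Coalgebra.counit (R := K) (contract f z) := by
    intro z
    induction z with
    | zero => simp
    | add y z hy hz => simp only [map_add, hy, hz]
    | tmul y a => simp
  simp only [LinearMap.comp_apply, h3] at h2
  simpa [psi] using h2

/-- Comodule axioms in terms of matrix coefficients. -/
lemma axioms_of_matrix {V : Type w} [AddCommGroup V] [Module K V] {ι : Type*} [Fintype ι]
    [DecidableEq ι] (b : ι → V) (hb : Submodule.span K (Set.range b) = ⊤)
    (ρ : V →ₗ[K] V ⊗[K] A) (a : ι → ι → A) (h : ∀ j, ρ (b j) = ∑ i, b i ⊗ₜ[K] a i j)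
    (hΔ : ∀ i j, Coalgebra.comul (R := K) (a i j) = ∑ r, a i r ⊗ₜ[K] a r j)
    (hε : ∀ i j, Coalgebra.counit (R := K) (a i j) = if i = j then 1 else 0) :
    (TensorProduct.assoc K V A A).toLinearMap ∘ₗ ρ.rTensor A ∘ₗ ρ =
      (Coalgebra.comul (R := K) (A := A)).lTensor V ∘ₗ ρ ∧
    (Coalgebra.counit (R := K) (A := A)).lTensor V ∘ₗ ρ = (TensorProduct.mk K V K).flip 1 := by
  constructor
  · apply LinearMap.ext_on hb
    rintro _ ⟨j, rfl⟩
    simp only [LinearMap.comp_apply, h, map_sum, LinearMap.rTensor_tmul, LinearMap.lTensor_tmul,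
      hΔ, TensorProduct.sum_tmul, TensorProduct.tmul_sum, LinearEquiv.coe_coe,
      TensorProduct.assoc_tmul]
    rw [Finset.sum_comm]
  · apply LinearMap.ext_on hb
    rintro _ ⟨j, rfl⟩
    simp [h, hε, TensorProduct.tmul_ite]

end Matrix

section Operations

variable {K : Type u} {A : Type v} [Field K] [CommRing A] [HopfAlgebra K A]

/-- The trivial representation `1`. -/
abbrev DiffRep.triv (K : Type u) (A : Type v) [Field K] [CommRing A] [HopfAlgebra K A] : DiffRep K A where
  carrier := K
  ρ := (TensorProduct.mk K K A).flip 1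
  coassoc := by ext; simp [Algebra.TensorProduct.one_def]
  counit := by ext; simp

/-- The coaction `v ⊗ w ↦ ∑ v_i ⊗ w_j ⊗ a_i b_j` on `V ⊗ W`, where `ρ v = ∑ v_i ⊗ a_i` and
`ρ w = ∑ w_j ⊗ b_j`. -/
def tensorρ (V W : DiffRep K A) : V ⊗[K] W →ₗ[K] (V ⊗[K] W) ⊗[K] A :=
  (LinearMap.mul' K A).lTensor (V ⊗[K] W) ∘ₗ
    (TensorProduct.tensorTensorTensorComm K V A W A).toLinearMap ∘ₗ TensorProduct.map V.ρ W.ρ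

lemma tensorρ_tmul (V W : DiffRep K A) {ι κ : Type*} [Fintype ι] [Fintype κ]
    (b : Module.Basis ι K V) (c : Module.Basis κ K W) (x : V) (y : W) :
    tensorρ V W (x ⊗ₜ y) = ∑ p : ι × κ, (b p.1 ⊗ₜ[K] c p.2) ⊗ₜ[K]
      (psi V x (b.coord p.1) * psi W y (c.coord p.2)) := by
  simp only [tensorρ, LinearMap.comp_apply, TensorProduct.map_tmul, rho_basis V b x,
    rho_basis W c y, TensorProduct.sum_tmul, TensorProduct.tmul_sum, map_sum]
  rw [Fintype.sum_prod_type, Finset.sum_comm]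
  simp

lemma tensor_axioms (V W : DiffRep K A) :
    (TensorProduct.assoc K (V ⊗[K] W) A A).toLinearMap ∘ₗ (tensorρ V W).rTensor A ∘ₗ tensorρ V W =
      (Coalgebra.comul (R := K) (A := A)).lTensor (V ⊗[K] W) ∘ₗ tensorρ V W ∧
    (Coalgebra.counit (R := K) (A := A)).lTensor (V ⊗[K] W) ∘ₗ tensorρ V W =
      (TensorProduct.mk K (V ⊗[K] W) K).flip 1 := by
  classical
  let b := Module.finBasis K V
  let c := Module.finBasis K W
  refine axioms_of_matrix (b.tensorProduct c) (b.tensorProduct c).span_eq _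
    (fun p q => psi V (b q.1) (b.coord p.1) * psi W (c q.2) (c.coord p.2)) ?_ ?_ ?_
  · rintro ⟨i, j⟩
    rw [Module.Basis.tensorProduct_apply, tensorρ_tmul V W b c]
    exact Finset.sum_congr rfl fun p _ => by rw [Module.Basis.tensorProduct_apply']
  · rintro ⟨i, j⟩ ⟨k, l⟩
    rw [Bialgebra.comul_mul, comul_psi V b, comul_psi W c, Finset.sum_mul_sum,
      Fintype.sum_prod_type]
    simp
  · rintro ⟨i, j⟩ ⟨k, l⟩
    simp only [Bialgebra.counit_mul, counit_psi, Module.Basis.coord_apply,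
      Module.Basis.repr_self, Finsupp.single_apply, Prod.mk.injEq]
    by_cases h1 : i = k <;> by_cases h2 : j = l <;>
      simp [h1, h2, Ne.symm]

/-- The tensor product of representations. -/
abbrev DiffRep.tensor (V W : DiffRep K A) : DiffRep K A where
  carrier := V ⊗[K] W
  ρ := tensorρ V W
  coassoc := (tensor_axioms V W).1
  counit := (tensor_axioms V W).2

/-- The coaction on `V*`, corresponding to `(g u)(v) = u(g⁻¹ v)`: the element `ρ u` of
`V* ⊗ A ≅ Hom(V, A)` is the linear map `v ↦ S (ψ_V(v ⊗ u))`. -/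
def dualρ (V : DiffRep K A) : Module.Dual K V →ₗ[K] Module.Dual K V ⊗[K] A where
  toFun f := (dualTensorHomEquiv K V A).symm
    ((HopfAlgebra.antipode K (A := A)) ∘ₗ contract f ∘ₗ V.ρ)
  map_add' f g := by
    rw [← map_add]
    congr 1
    ext x
    simp [contract, LinearMap.rTensor_add]
  map_smul' c f := by
    rw [RingHom.id_apply, ← map_smul]
    congr 1
    ext x
    simp [contract, LinearMap.rTensor_smul]

lemma dualρ_basis (V : DiffRep K A) {ι : Type*} [Fintype ι] (b : Module.Basis ι K V)
    (f : Module.Dual K V) :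
    dualρ V f = ∑ i, b.coord i ⊗ₜ[K] HopfAlgebra.antipode K (psi V (b i) f) := by
  classical
  change (dualTensorHomEquiv K V A).symm _ = _
  rw [LinearEquiv.symm_apply_eq]
  apply b.ext
  intro j
  simp [dualTensorHomEquiv, dualTensorHom_apply, Finsupp.single_apply, psi]

/-- The inverse of the matrix of coefficients is given by the antipode. -/
lemma comul_antipode_psi (V : DiffRep K A) {ι : Type*} [Fintype ι]
    (b : Module.Basis ι K V) (i j : ι) :
    Coalgebra.comul (R := K) (HopfAlgebra.antipode K (psi V (b j) (b.coord i))) =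
      ∑ r, HopfAlgebra.antipode K (psi V (b j) (b.coord r)) ⊗ₜ[K]
        HopfAlgebra.antipode K (psi V (b r) (b.coord i)) := by
  classical
  let M : Matrix ι ι A := fun i j => psi V (b j) (b.coord i)
  let N : Matrix ι ι A := fun i j => HopfAlgebra.antipode K (psi V (b j) (b.coord i))
  have hc : ∀ i j, Coalgebra.counit (R := K) (M i j) = if i = j then 1 else 0 := by
    intro i j
    simp [M, counit_psi, Finsupp.single_apply, eq_comm]
  have hN : N * M = 1 := by
    ext i j
    have h := HopfAlgebra.mul_antipode_rTensor_comul_apply (R := K) (M i j)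
    rw [hc, show M i j = psi V (b j) (b.coord i) from rfl, comul_psi V b] at h
    simp only [map_sum, LinearMap.rTensor_tmul, LinearMap.mul'_apply] at h
    rw [Matrix.mul_apply, Matrix.one_apply]
    simp only [N, M, h]
    split_ifs <;> simp
  have hN' : M * N = 1 := by
    ext i j
    have h := HopfAlgebra.mul_antipode_lTensor_comul_apply (R := K) (M i j)
    rw [hc, show M i j = psi V (b j) (b.coord i) from rfl, comul_psi V b] at h
    simp only [map_sum, LinearMap.lTensor_tmul, LinearMap.mul'_apply] at h
    rw [Matrix.mul_apply, Matrix.one_apply]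
    simp only [N, M, h]
    split_ifs <;> simp
  let Δ := Bialgebra.comulAlgHom K A
  let l : A →ₐ[K] A ⊗[K] A := Algebra.TensorProduct.includeLeft
  let r : A →ₐ[K] A ⊗[K] A := Algebra.TensorProduct.includeRight
  have e1 : M.map Δ = M.map l * M.map r := by
    ext i j
    rw [Matrix.mul_apply]
    change Coalgebra.comul (R := K) (psi V (b j) (b.coord i)) =
      ∑ x, (psi V (b x) (b.coord i) ⊗ₜ[K] (1 : A)) * ((1 : A) ⊗ₜ[K] psi V (b j) (b.coord x))
    simp only [comul_psi V b, Algebra.TensorProduct.tmul_mul_tmul, one_mul, mul_one]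
  have e2 : N.map Δ * M.map Δ = 1 := by
    rw [← Matrix.map_mul, hN, Matrix.map_one _ (map_zero _) (map_one _)]
  have el : M.map l * N.map l = 1 := by
    rw [← Matrix.map_mul, hN', Matrix.map_one _ (map_zero _) (map_one _)]
  have er : M.map r * N.map r = 1 := by
    rw [← Matrix.map_mul, hN', Matrix.map_one _ (map_zero _) (map_one _)]
  have e3 : N.map Δ = N.map r * N.map l := by
    have : M.map Δ * (N.map r * N.map l) = 1 := by
      rw [e1, Matrix.mul_assoc, ← Matrix.mul_assoc (M.map r), er, Matrix.one_mul, el]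
    calc N.map Δ = N.map Δ * (M.map Δ * (N.map r * N.map l)) := by rw [this, Matrix.mul_one]
      _ = N.map r * N.map l := by rw [← Matrix.mul_assoc, e2, Matrix.one_mul]
  have := congrFun (congrFun e3 i) j
  rw [Matrix.mul_apply] at this
  change Coalgebra.comul (R := K) (N i j) =
    ∑ x, ((1 : A) ⊗ₜ[K] N i x) * (N x j ⊗ₜ[K] (1 : A)) at this
  simpa only [Algebra.TensorProduct.tmul_mul_tmul, one_mul, mul_one] using this

lemma dual_axioms (V : DiffRep K A) :
    (TensorProduct.assoc K (Module.Dual K V) A A).toLinearMap ∘ₗ (dualρ V).rTensor A ∘ₗ dualρ V =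
      (Coalgebra.comul (R := K) (A := A)).lTensor (Module.Dual K V) ∘ₗ dualρ V ∧
    (Coalgebra.counit (R := K) (A := A)).lTensor (Module.Dual K V) ∘ₗ dualρ V =
      (TensorProduct.mk K (Module.Dual K V) K).flip 1 := by
  classical
  let b := Module.finBasis K V
  refine axioms_of_matrix b.dualBasis b.dualBasis.span_eq _
    (fun i j => HopfAlgebra.antipode K (psi V (b i) (b.coord j))) ?_ ?_ ?_
  · intro j
    simp only [Module.Basis.coe_dualBasis, dualρ_basis V b]
  · intro i j
    rw [comul_antipode_psi]
  · intro i j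
    simp [counit_psi, Finsupp.single_apply]

/-- The dual representation. -/
abbrev DiffRep.dual (V : DiffRep K A) : DiffRep K A where
  carrier := Module.Dual K V
  ρ := dualρ V
  coassoc := (dual_axioms V).1
  counit := (dual_axioms V).2

end Operations

/-! ### Prolongation -/

section Prolongation

/-- The prolongation `V⁽¹⁾ = K[∂]_{≤ 1} ⊗_K V`. Since `1, ∂` is a basis of `K[∂]_{≤ 1}` as a right
`K`-space, every element is `1 ⊗ x + ∂ ⊗ y` for a unique pair `(x, y)`. As `c ∂ = ∂ c - c′` for
`c ∈ K`, the left multiplication is `c (1 ⊗ x + ∂ ⊗ y) = 1 ⊗ (c x - c′ y) + ∂ ⊗ c y`.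
See `Prolong.existsUnique_balanced` for the universal property of the tensor product. -/
@[ext] structure Prolong (K : Type u) (V : Type w) where
  fst : V
  snd : V

namespace Prolong

variable {K : Type u} [Field K] [Differential K] {V : Type w} [AddCommGroup V] [Module K V]

instance : Zero (Prolong K V) := ⟨⟨0, 0⟩⟩
instance : Add (Prolong K V) := ⟨fun x y => ⟨x.fst + y.fst, x.snd + y.snd⟩⟩
instance : Neg (Prolong K V) := ⟨fun x => ⟨-x.fst, -x.snd⟩⟩
instance : SMul K (Prolong K V) := ⟨fun c x => ⟨c • x.fst - c′ • x.snd, c • x.snd⟩⟩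

@[simp] lemma zero_fst : (0 : Prolong K V).fst = 0 := rfl
@[simp] lemma zero_snd : (0 : Prolong K V).snd = 0 := rfl
@[simp] lemma add_fst (x y : Prolong K V) : (x + y).fst = x.fst + y.fst := rfl
@[simp] lemma add_snd (x y : Prolong K V) : (x + y).snd = x.snd + y.snd := rfl
@[simp] lemma neg_fst (x : Prolong K V) : (-x).fst = -x.fst := rfl
@[simp] lemma neg_snd (x : Prolong K V) : (-x).snd = -x.snd := rfl
@[simp] lemma smul_fst (c : K) (x : Prolong K V) : (c • x).fst = c • x.fst - c′ • x.snd := rfl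
@[simp] lemma smul_snd (c : K) (x : Prolong K V) : (c • x).snd = c • x.snd := rfl

instance : AddCommGroup (Prolong K V) where
  add_assoc x y z := by ext <;> simp [add_assoc]
  zero_add x := by ext <;> simp
  add_zero x := by ext <;> simp
  add_comm x y := by ext <;> simp [add_comm]
  neg_add_cancel x := by ext <;> simp
  nsmul := nsmulRec
  zsmul := zsmulRec

instance : Module K (Prolong K V) where
  one_smul x := by ext <;> simp
  mul_smul c d x := by
    ext
    · simp only [smul_fst, smul_snd, Derivation.leibniz, smul_eq_mul, smul_sub, add_smul, mul_smul,
        smul_comm d (c′)]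
      abel
    · simp [mul_smul]
  smul_zero c := by ext <;> simp
  smul_add c x y := by
    ext
    · simp only [smul_fst, add_fst, add_snd, smul_add]; abel
    · simp
  add_smul c d x := by
    ext
    · simp only [smul_fst, add_fst, map_add, add_smul]; abel
    · simp [add_smul]
  zero_smul x := by ext <;> simp

/-- The embedding `v ↦ 1 ⊗ v` of `V` into `V⁽¹⁾`. -/
def incl (K : Type u) [Field K] [Differential K] (V : Type w) [AddCommGroup V] [Module K V] :
    V →ₗ[K] Prolong K V where
  toFun x := ⟨x, 0⟩
  map_add' x y := by ext <;> simp
  map_smul' c x := by ext <;> simp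

/-- The additive map `v ↦ ∂ v = ∂ ⊗ v` from `V` to `V⁽¹⁾`. -/
def d (K : Type u) [Field K] [Differential K] (V : Type w) [AddCommGroup V] [Module K V] :
    V →+ Prolong K V where
  toFun x := ⟨0, x⟩
  map_zero' := rfl
  map_add' x y := by ext <;> simp

@[simp] lemma incl_fst (x : V) : (incl K V x).fst = x := rfl
@[simp] lemma incl_snd (x : V) : (incl K V x).snd = 0 := rfl
@[simp] lemma d_fst (x : V) : (d K V x).fst = 0 := rfl
@[simp] lemma d_snd (x : V) : (d K V x).snd = x := rfl

lemma d_smul (c : K) (x : V) : d K V (c • x) = c • d K V x + c′ • incl K V x := by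
  ext <;> simp

lemma eq_incl_add_d (z : Prolong K V) : z = incl K V z.fst + d K V z.snd := by
  ext <;> simp

/-- `V⁽¹⁾` is the tensor product over `K` of the right `K`-space `K[∂]_{≤ 1}` (where
`(a + b ∂) c = (a c + b c′) + b c ∂`) and the left `K`-space `V`: a biadditive map `β(a + b ∂, v)`
that is balanced factors uniquely through `(a + b ∂) ⊗ v := a v + b ∂ v`. -/
lemma existsUnique_balanced {W : Type*} [AddCommGroup W] (β : K × K →+ V →+ W)
    (hβ : ∀ (a b c : K) (x : V), β (a * c + b * c′, b * c) x = β (a, b) (c • x)) :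
    ∃! f : Prolong K V →+ W, ∀ (a b : K) (x : V),
      f (a • incl K V x + b • d K V x) = β (a, b) x := by
  have key : ∀ (a b : K) (x : V), β (1, 0) (a • x) + (β (0, 1) (b • x) - β (1, 0) (b′ • x)) =
      β (a, b) x := by
    intro a b x
    rw [← hβ, ← hβ, ← hβ, ← AddMonoidHom.sub_apply, ← AddMonoidHom.add_apply, ← map_sub,
      ← map_add]
    simp
  refine ⟨AddMonoidHom.mk' (fun z => β (1, 0) z.fst + β (0, 1) z.snd) ?_, ?_, ?_⟩
  · intro x y
    simp only [add_fst, add_snd, map_add]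
    abel
  · intro a b x
    rw [← key]
    simp [sub_eq_add_neg]
    abel
  · intro g hg
    ext z
    have h1 := hg 1 0 z.fst
    have h2 := hg 0 1 z.snd
    simp only [one_smul, zero_smul, add_zero, zero_add] at h1 h2
    conv_lhs => rw [eq_incl_add_d z, map_add, h1, h2]
    rfl

/-- The linear map on `V⁽¹⁾` given by `1 ⊗ x ↦ f x` and `∂ ⊗ x ↦ D x`. -/
def lift {W : Type*} [AddCommGroup W] [Module K W] (f : V →ₗ[K] W) (D : V →+ W)
    (h : ∀ (c : K) (x : V), D (c • x) = c • D x + c′ • f x) : Prolong K V →ₗ[K] W where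
  toFun z := f z.fst + D z.snd
  map_add' x y := by simp only [add_fst, add_snd, map_add]; abel
  map_smul' c x := by
    simp only [smul_fst, smul_snd, map_sub, map_smul, h, RingHom.id_apply, smul_add]
    abel

@[simp] lemma lift_incl {W : Type*} [AddCommGroup W] [Module K W] (f : V →ₗ[K] W) (D : V →+ W)
    (h : ∀ (c : K) (x : V), D (c • x) = c • D x + c′ • f x) (x : V) :
    lift f D h (incl K V x) = f x := by simp [lift]

@[simp] lemma lift_d {W : Type*} [AddCommGroup W] [Module K W] (f : V →ₗ[K] W) (D : V →+ W)
    (h : ∀ (c : K) (x : V), D (c • x) = c • D x + c′ • f x) (x : V) :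
    lift f D h (d K V x) = D x := by simp [lift]

lemma hom_ext {W : Type*} [AddCommGroup W] [Module K W] {f g : Prolong K V →ₗ[K] W}
    (h1 : ∀ x, f (incl K V x) = g (incl K V x)) (h2 : ∀ x, f (d K V x) = g (d K V x)) : f = g := by
  ext z
  rw [eq_incl_add_d z, map_add, map_add, h1, h2]

/-- The functional `F(u)` on `V⁽¹⁾`: `F(u)(v) = u(v)` and `F(u)(∂ v) = u(v)′`. -/
def F (f : Module.Dual K V) : Module.Dual K (Prolong K V) :=
  lift f ((Differential.deriv : Derivation ℤ K K).toLinearMap.toAddMonoidHom.comp f.toAddMonoidHom)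
    (fun c x => by simp [mul_comm])

@[simp] lemma F_incl (f : Module.Dual K V) (x : V) : F f (incl K V x) = f x := lift_incl ..
@[simp] lemma F_d (f : Module.Dual K V) (x : V) : F f (d K V x) = (f x)′ := lift_d ..

lemma span_basis {ι : Type*} [Fintype ι] (b : Module.Basis ι K V) :
    Submodule.span K (Set.range (Sum.elim (fun i => incl K V (b i)) (fun i => d K V (b i)))) =
      ⊤ := by
  rw [eq_top_iff]
  have h1 : ∀ i, incl K V (b i) ∈ Submodule.span K
      (Set.range (Sum.elim (fun i => incl K V (b i)) (fun i => d K V (b i)))) :=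
    fun i => Submodule.subset_span ⟨Sum.inl i, rfl⟩
  have h2 : ∀ i, d K V (b i) ∈ Submodule.span K
      (Set.range (Sum.elim (fun i => incl K V (b i)) (fun i => d K V (b i)))) :=
    fun i => Submodule.subset_span ⟨Sum.inr i, rfl⟩
  intro z _
  rw [eq_incl_add_d z]
  refine add_mem ?_ ?_
  · rw [← b.sum_repr z.fst, map_sum]
    exact sum_mem fun i _ => by rw [map_smul]; exact Submodule.smul_mem _ _ (h1 i)
  · rw [← b.sum_repr z.snd, map_sum]
    exact sum_mem fun i _ => by
      rw [d_smul]
      exact add_mem (Submodule.smul_mem _ _ (h2 i)) (Submodule.smul_mem _ _ (h1 i))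

instance [Module.Finite K V] : Module.Finite K (Prolong K V) :=
  ⟨⟨(Set.finite_range _).toFinset, by
    rw [Set.Finite.coe_toFinset]; exact span_basis (Module.finBasis K V)⟩⟩

end Prolong

variable {K : Type u} {A : Type v} [Field K] [Differential K] [CommRing A] [HopfAlgebra K A]
  [Differential A] [DifferentialAlgebra K A]

/-- The derivation `V ⊗ A → V⁽¹⁾ ⊗ A`, `v ⊗ a ↦ ∂ v ⊗ a + v ⊗ a′`. -/
def derivTensor (K : Type u) (A : Type v) [Field K] [Differential K] [CommRing A] [Algebra K A]
    [Differential A] [DifferentialAlgebra K A] (V : Type w) [AddCommGroup V] [Module K V] :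
    V ⊗[K] A →+ Prolong K V ⊗[K] A :=
  TensorProduct.liftAddHom
    (AddMonoidHom.mk' (fun x => AddMonoidHom.mk'
        (fun a => Prolong.d K V x ⊗ₜ[K] a + Prolong.incl K V x ⊗ₜ[K] a′)
        (fun a b => by simp only [map_add, TensorProduct.tmul_add]; abel))
      (fun x y => by
        ext a
        simp only [map_add, TensorProduct.add_tmul, AddMonoidHom.mk'_apply, AddMonoidHom.add_apply]
        abel))
    (fun c x a => by
      simp only [AddMonoidHom.mk'_apply, deriv_smul, Prolong.d_smul, map_smul,
        TensorProduct.add_tmul, TensorProduct.tmul_add, TensorProduct.smul_tmul]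
      abel)

@[simp] lemma derivTensor_tmul {V : Type w} [AddCommGroup V] [Module K V] (x : V) (a : A) :
    derivTensor K A V (x ⊗ₜ a) =
      Prolong.d K V x ⊗ₜ[K] a + Prolong.incl K V x ⊗ₜ[K] a′ := rfl

lemma derivTensor_smul {V : Type w} [AddCommGroup V] [Module K V] (c : K) (z : V ⊗[K] A) :
    derivTensor K A V (c • z) =
      c • derivTensor K A V z + c′ • (Prolong.incl K V).rTensor A z := by
  induction z with
  | zero => simp
  | add y z hy hz => simp only [smul_add, map_add, hy, hz]; abel
  | tmul x a =>
    simp only [TensorProduct.smul_tmul', derivTensor_tmul, Prolong.d_smul, map_smul,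
      TensorProduct.add_tmul, LinearMap.rTensor_tmul, smul_add]
    abel

/-- The prolonged coaction on `V⁽¹⁾`: it extends `ρ`, and `ρ (∂ v) = ∂ (ρ v)`. -/
def prolongρ (V : DiffRep K A) : Prolong K V →ₗ[K] Prolong K V ⊗[K] A :=
  Prolong.lift ((Prolong.incl K V).rTensor A ∘ₗ V.ρ)
    ((derivTensor K A V).comp V.ρ.toAddMonoidHom)
    (fun c x => by simp [derivTensor_smul])

lemma prolongρ_incl (V : DiffRep K A) (x : V) :
    prolongρ V (Prolong.incl K V x) = (Prolong.incl K V.carrier).rTensor A (V.ρ x) :=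
  Prolong.lift_incl _ _ _ x

lemma prolongρ_d (V : DiffRep K A) (x : V) :
    prolongρ V (Prolong.d K V x) = derivTensor K A V.carrier (V.ρ x) :=
  Prolong.lift_d _ _ _ x

lemma prolong_axioms [hA : DifferentialHopfAlgebra K A] (V : DiffRep K A) :
    (TensorProduct.assoc K (Prolong K V) A A).toLinearMap ∘ₗ (prolongρ V).rTensor A ∘ₗ prolongρ V =
      (Coalgebra.comul (R := K) (A := A)).lTensor (Prolong K V) ∘ₗ prolongρ V ∧
    (Coalgebra.counit (R := K) (A := A)).lTensor (Prolong K V) ∘ₗ prolongρ V =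
      (TensorProduct.mk K (Prolong K V) K).flip 1 := by
  classical
  let b := Module.finBasis K V
  have hΔ : ∀ x : A, Coalgebra.comul (R := K) (x′) = (Coalgebra.comul (R := K) x)′ :=
    fun x => (hA.isDifferentialHopf.deriv_comul x).symm
  have hε : ∀ x : A, Coalgebra.counit (R := K) (x′) = (Coalgebra.counit (R := K) x)′ :=
    fun x => (hA.isDifferentialHopf.deriv_counit x).symm
  let a : Fin (Module.finrank K V) → Fin (Module.finrank K V) → A :=
    fun i j => psi V (b j) (b.coord i)
  refine axioms_of_matrix _ (Prolong.span_basis b) _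
    (Sum.elim (fun i => Sum.elim (fun j => a i j) (fun j => (a i j)′))
      (fun i => Sum.elim (fun j => 0) (fun j => a i j))) ?_ ?_ ?_
  · rintro (j | j)
    · rw [Sum.elim_inl, prolongρ_incl, rho_basis V b (b j)]
      simp [a]
    · rw [Sum.elim_inr, prolongρ_d, rho_basis V b (b j)]
      simp [a, Finset.sum_add_distrib, add_comm]
  · rintro (i | i) (j | j) <;>
    simp [a, comul_psi V b, hΔ, Finset.sum_add_distrib, add_comm]
  · rintro (i | i) (j | j) <;>
    simp [a, counit_psi, hε, Finsupp.single_apply, eq_comm]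
    split_ifs <;> simp

/-- The prolongation `V⁽¹⁾` of a representation. -/
abbrev DiffRep.prolong [DifferentialHopfAlgebra K A] (V : DiffRep K A) : DiffRep K A where
  carrier := Prolong K V
  ρ := prolongρ V
  coassoc := (prolong_axioms V).1
  counit := (prolong_axioms V).2

end Prolongation

/-! ### Some equivariant maps -/

section Equivariant

variable {K : Type u} {A : Type v} [Field K] [CommRing A] [HopfAlgebra K A]

/-- The bilinear map `(v ⊗ a, w ⊗ b) ↦ (v ⊗ w) ⊗ a b`. -/
def mulT {V W : Type w} [AddCommGroup V] [Module K V] [AddCommGroup W] [Module K W]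
    (y : V ⊗[K] A) (z : W ⊗[K] A) : (V ⊗[K] W) ⊗[K] A :=
  (LinearMap.mul' K A).lTensor (V ⊗[K] W) (TensorProduct.tensorTensorTensorComm K V A W A (y ⊗ₜ z))

section

variable {V W X : Type w} [AddCommGroup V] [Module K V] [AddCommGroup W] [Module K W]
  [AddCommGroup X] [Module K X]

lemma mulT_tmul (x : V) (a : A) (y : W) (b : A) :
    mulT (x ⊗ₜ[K] a) (y ⊗ₜ[K] b) = (x ⊗ₜ[K] y) ⊗ₜ[K] (a * b) := by simp [mulT]

lemma zero_mulT (z : W ⊗[K] A) : mulT (0 : V ⊗[K] A) z = 0 := by simp [mulT]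
lemma mulT_zero (y : V ⊗[K] A) : mulT y (0 : W ⊗[K] A) = 0 := by simp [mulT]
lemma add_mulT (x y : V ⊗[K] A) (z : W ⊗[K] A) : mulT (x + y) z = mulT x z + mulT y z := by
  simp [mulT, TensorProduct.add_tmul]
lemma mulT_add (x : V ⊗[K] A) (y z : W ⊗[K] A) : mulT x (y + z) = mulT x y + mulT x z := by
  simp [mulT, TensorProduct.tmul_add]

lemma mulT_comm (y : V ⊗[K] A) (z : W ⊗[K] A) :
    (TensorProduct.comm K V W).toLinearMap.rTensor A (mulT y z) = mulT z y := by
  induction y with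
  | zero => simp [zero_mulT, mulT_zero]
  | add y y' h h' => simp only [add_mulT, mulT_add, map_add, h, h']
  | tmul x a =>
    induction z with
    | zero => simp [zero_mulT, mulT_zero]
    | add y y' h h' => simp only [add_mulT, mulT_add, map_add, h, h']
    | tmul y b => simp [mulT_tmul, mul_comm]

lemma mulT_assoc (x : V ⊗[K] A) (y : W ⊗[K] A) (z : X ⊗[K] A) :
    (TensorProduct.assoc K V W X).toLinearMap.rTensor A (mulT (mulT x y) z) =
      mulT x (mulT y z) := by
  induction x with
  | zero => simp [zero_mulT]
  | add y y' h h' => simp only [add_mulT, map_add, h, h']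
  | tmul x a =>
    induction y with
    | zero => simp [zero_mulT, mulT_zero]
    | add y y' h h' => simp only [add_mulT, mulT_add, map_add, h, h']
    | tmul y b =>
      induction z with
      | zero => simp [mulT_zero]
      | add y y' h h' => simp only [mulT_add, map_add, h, h']
      | tmul z c => simp [mulT_tmul, mul_assoc]

lemma map_mulT {V' W' : Type w} [AddCommGroup V'] [Module K V'] [AddCommGroup W'] [Module K W']
    (f : V →ₗ[K] V') (g : W →ₗ[K] W') (y : V ⊗[K] A) (z : W ⊗[K] A) :
    (TensorProduct.map f g).rTensor A (mulT y z) = mulT (f.rTensor A y) (g.rTensor A z) := by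
  induction y with
  | zero => simp [zero_mulT]
  | add y y' h h' => simp only [add_mulT, map_add, h, h']
  | tmul x a =>
    induction z with
    | zero => simp [mulT_zero]
    | add y y' h h' => simp only [mulT_add, map_add, h, h']
    | tmul y b => simp [mulT_tmul]

end

lemma tensorρ_eq (V W : DiffRep K A) (x : V) (y : W) :
    tensorρ V W (x ⊗ₜ y) = mulT (V.ρ x) (W.ρ y) := rfl

section RawMaps

variable [Differential K]

/-- The projection `V⁽¹⁾ → V`, `1 ⊗ v ↦ 0`, `∂ ⊗ v ↦ v`. -/
def projLin (K : Type u) [Field K] [Differential K] (V : Type w) [AddCommGroup V] [Module K V] :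
    Prolong K V →ₗ[K] V := Prolong.lift 0 (AddMonoidHom.id V) (by simp)

@[simp] lemma projLin_incl {V : Type w} [AddCommGroup V] [Module K V] (x : V) :
    projLin K V (Prolong.incl K V x) = 0 := Prolong.lift_incl ..

@[simp] lemma projLin_d {V : Type w} [AddCommGroup V] [Module K V] (x : V) :
    projLin K V (Prolong.d K V x) = x := Prolong.lift_d ..

/-- The prolongation `V⁽¹⁾ → W⁽¹⁾` of a linear map. -/
def prolongMap {V W : Type w} [AddCommGroup V] [Module K V] [AddCommGroup W] [Module K W]
    (f : V →ₗ[K] W) : Prolong K V →ₗ[K] Prolong K W :=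
  Prolong.lift (Prolong.incl K W ∘ₗ f) ((Prolong.d K W).comp f.toAddMonoidHom)
    (by simp [Prolong.d_smul])

@[simp] lemma prolongMap_incl {V W : Type w} [AddCommGroup V] [Module K V] [AddCommGroup W]
    [Module K W] (f : V →ₗ[K] W) (x : V) :
    prolongMap f (Prolong.incl K V x) = Prolong.incl K W (f x) := Prolong.lift_incl ..

@[simp] lemma prolongMap_d {V W : Type w} [AddCommGroup V] [Module K V] [AddCommGroup W]
    [Module K W] (f : V →ₗ[K] W) (x : V) :
    prolongMap f (Prolong.d K V x) = Prolong.d K W (f x) := Prolong.lift_d ..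

/-- The additive map `v ⊗ w ↦ ∂ v ⊗ w + v ⊗ ∂ w`. -/
def leibnizAux (K : Type u) [Field K] [Differential K] (V W : Type w) [AddCommGroup V] [Module K V]
    [AddCommGroup W] [Module K W] : V ⊗[K] W →+ Prolong K V ⊗[K] Prolong K W :=
  TensorProduct.liftAddHom
    (AddMonoidHom.mk' (fun x => AddMonoidHom.mk'
        (fun y => Prolong.d K V x ⊗ₜ[K] Prolong.incl K W y +
          Prolong.incl K V x ⊗ₜ[K] Prolong.d K W y)
        (fun a b => by simp only [map_add, TensorProduct.tmul_add]; abel))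
      (fun x y => by
        ext a
        simp only [map_add, TensorProduct.add_tmul, AddMonoidHom.mk'_apply, AddMonoidHom.add_apply]
        abel))
    (fun c x a => by
      simp only [AddMonoidHom.mk'_apply, Prolong.d_smul, map_smul,
        TensorProduct.add_tmul, TensorProduct.tmul_add, TensorProduct.smul_tmul]
      abel)

variable {V W : Type w} [AddCommGroup V] [Module K V] [AddCommGroup W] [Module K W]

@[simp] lemma leibnizAux_tmul (x : V) (y : W) : leibnizAux K V W (x ⊗ₜ y) =
      Prolong.d K V x ⊗ₜ[K] Prolong.incl K W y +
          Prolong.incl K V x ⊗ₜ[K] Prolong.d K W y := rfl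

lemma leibnizAux_smul (c : K) (z : V ⊗[K] W) :
    leibnizAux K V W (c • z) = c • leibnizAux K V W z +
      c′ • TensorProduct.map (Prolong.incl K V) (Prolong.incl K W) z := by
  induction z with
  | zero => simp
  | add y z hy hz => simp only [smul_add, map_add, hy, hz]; abel
  | tmul x a =>
    simp only [TensorProduct.smul_tmul', leibnizAux_tmul, Prolong.d_smul, map_smul,
      TensorProduct.add_tmul, TensorProduct.map_tmul, smul_add]
    abel

/-- The linear map `(V ⊗ W)⁽¹⁾ → V⁽¹⁾ ⊗ W⁽¹⁾` extending `V ⊗ W → V⁽¹⁾ ⊗ W⁽¹⁾` with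
`∂ (v ⊗ w) ↦ ∂ v ⊗ w + v ⊗ ∂ w`. -/
def leibnizLin (K : Type u) [Field K] [Differential K] (V W : Type w) [AddCommGroup V] [Module K V]
    [AddCommGroup W] [Module K W] : Prolong K (V ⊗[K] W) →ₗ[K] Prolong K V ⊗[K] Prolong K W :=
  Prolong.lift (TensorProduct.map (Prolong.incl K V) (Prolong.incl K W))
    (leibnizAux K V W) leibnizAux_smul

@[simp] lemma leibnizLin_incl (z : V ⊗[K] W) :
    leibnizLin K V W (Prolong.incl K _ z) =
      TensorProduct.map (Prolong.incl K V) (Prolong.incl K W) z := Prolong.lift_incl ..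

@[simp] lemma leibnizLin_d (z : V ⊗[K] W) :
    leibnizLin K V W (Prolong.d K _ z) = leibnizAux K V W z := Prolong.lift_d ..

variable [Differential A] [DifferentialAlgebra K A]

lemma leibniz_incl (y : V ⊗[K] A) (z : W ⊗[K] A) :
    mulT ((Prolong.incl K V).rTensor A y) ((Prolong.incl K W).rTensor A z) =
      (leibnizLin K V W).rTensor A ((Prolong.incl K (V ⊗[K] W)).rTensor A (mulT y z)) := by
  rw [← map_mulT]
  induction mulT y z with
  | zero => simp
  | add y y' h h' => simp only [map_add, h, h']
  | tmul y b => simp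

lemma leibniz_d (y : V ⊗[K] A) (z : W ⊗[K] A) :
    mulT (derivTensor K A V y) ((Prolong.incl K W).rTensor A z) +
      mulT ((Prolong.incl K V).rTensor A y) (derivTensor K A W z) =
      (leibnizLin K V W).rTensor A (derivTensor K A (V ⊗[K] W) (mulT y z)) := by
  induction y with
  | zero => simp [zero_mulT]
  | add y y' h h' =>
    simp only [map_add, add_mulT, ← h, ← h']
    abel
  | tmul x a =>
    induction z with
    | zero => simp [mulT_zero]
    | add y y' h h' =>
      simp only [map_add, mulT_add, ← h, ← h']
      abel
    | tmul y b =>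
      simp only [derivTensor_tmul, mulT_tmul, LinearMap.rTensor_tmul, add_mulT, mulT_add,
        map_add, leibnizLin_d, leibnizLin_incl, leibnizAux_tmul, TensorProduct.map_tmul,
        Derivation.leibniz, smul_eq_mul, TensorProduct.add_tmul, TensorProduct.tmul_add,
        _root_.mul_comm b]
      abel

end RawMaps

namespace DiffRep.Hom

lemma apply {V W : DiffRep K A} (φ : DiffRep.Hom V W) (x : V) :
    W.ρ (φ.toLin x) = φ.toLin.rTensor A (V.ρ x) := LinearMap.congr_fun φ.equivariant x

/-- The identity morphism. -/
def id (V : DiffRep K A) : DiffRep.Hom V V where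
  toLin := LinearMap.id
  equivariant := by simp

/-- The tensor product of two morphisms. -/
def tensorMap {V V' W W' : DiffRep K A} (φ : DiffRep.Hom V V') (χ : DiffRep.Hom W W') :
    DiffRep.Hom (V.tensor W) (V'.tensor W') where
  toLin := TensorProduct.map φ.toLin χ.toLin
  equivariant := by
    apply TensorProduct.ext'
    intro x y
    change mulT (V'.ρ (φ.toLin x)) (W'.ρ (χ.toLin y)) =
      (TensorProduct.map φ.toLin χ.toLin).rTensor A (mulT (V.ρ x) (W.ρ y))
    rw [map_mulT, φ.apply, χ.apply]

/-- The symmetry `V ⊗ W → W ⊗ V`. -/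
def comm (V W : DiffRep K A) : DiffRep.Hom (V.tensor W) (W.tensor V) where
  toLin := (TensorProduct.comm K V W).toLinearMap
  equivariant := by
    apply TensorProduct.ext'
    intro x y
    exact (mulT_comm (V.ρ x) (W.ρ y)).symm

/-- The associativity isomorphism. -/
def assoc (V W X : DiffRep K A) : DiffRep.Hom ((V.tensor W).tensor X) (V.tensor (W.tensor X)) where
  toLin := (TensorProduct.assoc K V W X).toLinearMap
  equivariant := by
    apply TensorProduct.ext_threefold
    intro x y z
    exact (mulT_assoc (V.ρ x) (W.ρ y) (X.ρ z)).symm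

lemma mulT_unit {V : Type u} [AddCommGroup V] [Module K V] (y : V ⊗[K] A) :
    mulT y ((1 : K) ⊗ₜ[K] (1 : A)) = ((TensorProduct.mk K V K).flip 1).rTensor A y := by
  induction y with
  | zero => simp [zero_mulT]
  | add y y' h h' => simp only [add_mulT, map_add, h, h']
  | tmul y b => simp [mulT_tmul]

/-- The map `V → V ⊗ 1`, `v ↦ v ⊗ 1`. -/
def unit (V : DiffRep K A) : DiffRep.Hom V (V.tensor (DiffRep.triv K A)) where
  toLin := (TensorProduct.mk K V K).flip 1
  equivariant := by
    apply LinearMap.ext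
    intro x
    exact mulT_unit (V.ρ x)

variable [Differential K] [Differential A] [DifferentialAlgebra K A] [DifferentialHopfAlgebra K A]

/-- The embedding `V → V⁽¹⁾`. -/
def incl (V : DiffRep K A) : DiffRep.Hom V V.prolong where
  toLin := Prolong.incl K V
  equivariant := by
    apply LinearMap.ext
    intro x
    exact prolongρ_incl V x

/-- The projection `V⁽¹⁾ → V`, `1 ⊗ v ↦ 0`, `∂ ⊗ v ↦ v`. -/
def proj (V : DiffRep K A) : DiffRep.Hom V.prolong V where
  toLin := projLin K V
  equivariant := by
    apply Prolong.hom_ext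
    · intro x
      change V.ρ (projLin K V.carrier (Prolong.incl K V.carrier x)) =
        (projLin K V.carrier).rTensor A (prolongρ V (Prolong.incl K V.carrier x))
      rw [prolongρ_incl, projLin_incl, map_zero]
      induction V.ρ x with
      | zero => simp
      | add y y' h h' => rw [map_add, map_add, ← h, ← h', add_zero]
      | tmul y b => simp
    · intro x
      change V.ρ (projLin K V.carrier (Prolong.d K V.carrier x)) =
        (projLin K V.carrier).rTensor A (prolongρ V (Prolong.d K V.carrier x))
      rw [prolongρ_d, projLin_d]
      induction V.ρ x with
      | zero => simp
      | add y y' h h' => rw [map_add, map_add, ← h, ← h']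
      | tmul y b => simp

/-- The prolongation of a morphism. -/
def prolong {V W : DiffRep K A} (φ : DiffRep.Hom V W) : DiffRep.Hom V.prolong W.prolong where
  toLin := prolongMap φ.toLin
  equivariant := by
    apply Prolong.hom_ext
    · intro x
      change prolongρ W (prolongMap φ.toLin (Prolong.incl K V.carrier x)) =
        (prolongMap φ.toLin).rTensor A (prolongρ V (Prolong.incl K V.carrier x))
      rw [prolongMap_incl, prolongρ_incl, prolongρ_incl, φ.apply]
      induction V.ρ x with
      | zero => simp
      | add y y' h h' => simp only [map_add, h, h']
      | tmul y b => simp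
    · intro x
      change prolongρ W (prolongMap φ.toLin (Prolong.d K V.carrier x)) =
        (prolongMap φ.toLin).rTensor A (prolongρ V (Prolong.d K V.carrier x))
      rw [prolongMap_d, prolongρ_d, prolongρ_d, φ.apply]
      induction V.ρ x with
      | zero => simp
      | add y y' h h' => simp only [map_add, h, h']
      | tmul y b => simp

/-- The morphism `(V ⊗ W)⁽¹⁾ → V⁽¹⁾ ⊗ W⁽¹⁾`, `∂ (v ⊗ w) ↦ ∂ v ⊗ w + v ⊗ ∂ w`. -/
def leibniz (V W : DiffRep K A) : DiffRep.Hom (V.tensor W).prolong (V.prolong.tensor W.prolong) where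
  toLin := leibnizLin K V W
  equivariant := by
    apply Prolong.hom_ext
    · intro z
      change tensorρ V.prolong W.prolong
          (leibnizLin K V.carrier W.carrier (Prolong.incl K (V.carrier ⊗[K] W.carrier) z)) =
        (leibnizLin K V.carrier W.carrier).rTensor A (prolongρ (V.tensor W) (Prolong.incl K _ z))
      rw [leibnizLin_incl, prolongρ_incl]
      change V.carrier ⊗[K] W.carrier at z
      induction z using TensorProduct.induction_on with
      | zero => simp
      | add y y' h h' =>
        simp only [map_add]
        exact congrArg₂ (· + ·) h h'
      | tmul x y =>
        change mulT (prolongρ V (Prolong.incl K V.carrier x))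
          (prolongρ W (Prolong.incl K W.carrier y)) = _
        rw [prolongρ_incl, prolongρ_incl]
        exact leibniz_incl (V.ρ x) (W.ρ y)
    · intro z
      change tensorρ V.prolong W.prolong
          (leibnizLin K V.carrier W.carrier (Prolong.d K (V.carrier ⊗[K] W.carrier) z)) =
        (leibnizLin K V.carrier W.carrier).rTensor A (prolongρ (V.tensor W) (Prolong.d K _ z))
      rw [leibnizLin_d, prolongρ_d]
      change V.carrier ⊗[K] W.carrier at z
      induction z using TensorProduct.induction_on with
      | zero => simp
      | add y y' h h' =>
        simp only [map_add]
        exact congrArg₂ (· + ·) h h'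
      | tmul x y =>
        rw [leibnizAux_tmul, map_add]
        change mulT (prolongρ V (Prolong.d K V.carrier x))
          (prolongρ W (Prolong.incl K W.carrier y)) + mulT (prolongρ V (Prolong.incl K V.carrier x))
          (prolongρ W (Prolong.d K W.carrier y)) = _
        rw [prolongρ_incl, prolongρ_incl, prolongρ_d, prolongρ_d]
        exact leibniz_d (V.ρ x) (W.ρ y)

end DiffRep.Hom

end Equivariant

/-! ### The reconstructed differential algebra -/

section Recon

variable (K : Type u) (A : Type v) [Field K] [CommRing A] [HopfAlgebra K A]

instance : DecidableEq (DiffRep K A) := Classical.decEq _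

/-- The vector space `⨁_V V ⊗ V*`, over all differential representations `V` of `G`. -/
abbrev BigSum : Type _ :=
  DirectSum (DiffRep K A) fun V => V.carrier ⊗[K] Module.Dual K V.carrier

/-- The canonical injections of the direct sum. -/
abbrev BigSum.i (V : DiffRep K A) : V.carrier ⊗[K] Module.Dual K V.carrier →ₗ[K] BigSum K A :=
  DirectSum.lof K (DiffRep K A) (fun V => V.carrier ⊗[K] Module.Dual K V.carrier) V

/-- The relations: the span of all `i_V ((id ⊗ φ*) z) - i_W ((φ ⊗ id) z)`, for equivariant
`φ : V → W` and `z ∈ V ⊗ W*`. -/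
def relations : Submodule K (BigSum K A) :=
  Submodule.span K {x | ∃ (V W : DiffRep K A) (φ : DiffRep.Hom V W)
    (z : V.carrier ⊗[K] Module.Dual K W.carrier),
    x = BigSum.i K A V (φ.toLin.dualMap.lTensor V.carrier z) -
      BigSum.i K A W (φ.toLin.rTensor (Module.Dual K W.carrier) z)}

/-- The reconstructed algebra `𝒜`. -/
def Recon : Type _ := BigSum K A ⧸ relations K A

instance : AddCommGroup (Recon K A) := inferInstanceAs (AddCommGroup (BigSum K A ⧸ relations K A))
instance : Module K (Recon K A) := inferInstanceAs (Module K (BigSum K A ⧸ relations K A))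

namespace Recon

variable {K A}

/-- The quotient map onto `𝒜`. -/
def proj : BigSum K A →ₗ[K] Recon K A := (relations K A).mkQ

/-- The map `a_V : V ⊗ V* → 𝒜`. -/
def a (V : DiffRep K A) : V.carrier ⊗[K] Module.Dual K V.carrier →ₗ[K] Recon K A :=
  proj ∘ₗ BigSum.i K A V

lemma a_rel {V W : DiffRep K A} (φ : DiffRep.Hom V W) (x : V) (t : Module.Dual K W.carrier) :
    a V (x ⊗ₜ (t ∘ₗ φ.toLin)) = a W (φ.toLin x ⊗ₜ t) := by
  have h : BigSum.i K A V (φ.toLin.dualMap.lTensor V.carrier (x ⊗ₜ t)) -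
      BigSum.i K A W (φ.toLin.rTensor (Module.Dual K W.carrier) (x ⊗ₜ t)) ∈ relations K A :=
    Submodule.subset_span ⟨V, W, φ, _, rfl⟩
  exact (Submodule.Quotient.eq _).2 h

lemma induction {p : Recon K A → Prop} (x : Recon K A)
    (ha : ∀ (V : DiffRep K A) (x : V.carrier) (f : Module.Dual K V.carrier), p (a V (x ⊗ₜ f)))
    (hadd : ∀ x y, p x → p y → p (x + y)) : p x := by
  have h0 : p 0 := by
    have := ha (DiffRep.triv K A) 0 0
    rwa [TensorProduct.zero_tmul, map_zero] at this
  obtain ⟨z, rfl⟩ := (relations K A).mkQ_surjective x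
  induction z using DirectSum.induction_on with
  | zero => rwa [map_zero]
  | of V z =>
    change p (a V z)
    induction z with
    | zero => rwa [map_zero]
    | add y z hy hz => rw [map_add]; exact hadd _ _ hy hz
    | tmul x f => exact ha V x f
  | add y z hy hz => rw [map_add]; exact hadd _ _ hy hz

/-- Linear maps out of `𝒜`. -/
def lift {N : Type*} [AddCommGroup N] [Module K N]
    (f : ∀ V : DiffRep K A, V.carrier ⊗[K] Module.Dual K V.carrier →ₗ[K] N)
    (hf : ∀ (V W : DiffRep K A) (φ : DiffRep.Hom V W) (x : V.carrier) (t : Module.Dual K W.carrier),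
      f V (x ⊗ₜ (t ∘ₗ φ.toLin)) = f W (φ.toLin x ⊗ₜ t)) : Recon K A →ₗ[K] N :=
  (relations K A).liftQ (DirectSum.toModule K (DiffRep K A) N f) (by
    rw [relations, Submodule.span_le]
    rintro _ ⟨V, W, φ, z, rfl⟩
    simp only [SetLike.mem_coe, LinearMap.mem_ker, map_sub, DirectSum.toModule_lof, sub_eq_zero]
    induction z with
    | zero => simp
    | add y z hy hz => simp only [map_add, hy, hz]
    | tmul x t => exact hf V W φ x t)

@[simp] lemma lift_a {N : Type*} [AddCommGroup N] [Module K N]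
    (f : ∀ V : DiffRep K A, V.carrier ⊗[K] Module.Dual K V.carrier →ₗ[K] N) (hf)
    (V : DiffRep K A) (z : V.carrier ⊗[K] Module.Dual K V.carrier) :
    lift f hf (a V z) = f V z := by
  change DirectSum.toModule K (DiffRep K A) N f (BigSum.i K A V z) = f V z
  rw [DirectSum.toModule_lof]

/-- The bilinear map `(v ⊗ u, w ⊗ t) ↦ a_{V ⊗ W} ((v ⊗ w) ⊗ (u ⊗ t))`. -/
def mulComp (V W : DiffRep K A) : V.carrier ⊗[K] Module.Dual K V.carrier →ₗ[K]
    W.carrier ⊗[K] Module.Dual K W.carrier →ₗ[K] Recon K A :=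
  TensorProduct.curry (a (V.tensor W) ∘ₗ
    (TensorProduct.dualDistrib K V.carrier W.carrier).lTensor (V.carrier ⊗[K] W.carrier) ∘ₗ
    (TensorProduct.tensorTensorTensorComm K V.carrier (Module.Dual K V.carrier)
      W.carrier (Module.Dual K W.carrier)).toLinearMap)

lemma mulComp_tmul (V W : DiffRep K A) (x : V) (f : Module.Dual K V.carrier) (y : W)
    (g : Module.Dual K W.carrier) :
    mulComp V W (x ⊗ₜ f) (y ⊗ₜ g) =
      a (V.tensor W) ((x ⊗ₜ y) ⊗ₜ TensorProduct.dualDistrib K V.carrier W.carrier (f ⊗ₜ g)) := by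
  simp [mulComp]

/-- The multiplication of `𝒜`. -/
def mulLin : Recon K A →ₗ[K] Recon K A →ₗ[K] Recon K A :=
  (lift (fun W => (lift (fun V => mulComp V W) (by
      intro V V' φ x t
      apply TensorProduct.ext'
      intro y g
      rw [mulComp_tmul, mulComp_tmul]
      have := a_rel (φ.tensorMap (DiffRep.Hom.id W)) (x ⊗ₜ y)
        (TensorProduct.dualDistrib K V'.carrier W.carrier (t ⊗ₜ g))
      rw [show (φ.tensorMap (DiffRep.Hom.id W)).toLin (x ⊗ₜ y) = φ.toLin x ⊗ₜ y from rfl] at this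
      rw [← this]
      congr 2
      ext; rfl)).flip) (by
    intro W W' φ y g
    ext z
    induction z using induction with
    | hadd z z' h h' => rw [map_add, map_add, h, h']
    | ha V x t =>
      simp only [LinearMap.flip_apply, lift_a]
      rw [mulComp_tmul, mulComp_tmul]
      have := a_rel ((DiffRep.Hom.id V).tensorMap φ) (x ⊗ₜ y)
        (TensorProduct.dualDistrib K V.carrier W'.carrier (t ⊗ₜ g))
      rw [show ((DiffRep.Hom.id V).tensorMap φ).toLin (x ⊗ₜ y) = x ⊗ₜ φ.toLin y from rfl] at this
      rw [← this]
      congr 2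
      ext; rfl)).flip

instance : Mul (Recon K A) := ⟨fun x y => mulLin x y⟩

lemma mul_def (x y : Recon K A) : x * y = mulLin x y := rfl

/-- The unit of `𝒜` comes from the trivial representation. -/
instance : One (Recon K A) := ⟨a (DiffRep.triv K A) ((1 : K) ⊗ₜ (LinearMap.id : K →ₗ[K] K))⟩

lemma one_def : (1 : Recon K A) = a (DiffRep.triv K A) ((1 : K) ⊗ₜ (LinearMap.id : K →ₗ[K] K)) := rfl

/-- `a_V(v ⊗ u) a_W(w ⊗ t) = a_{V ⊗ W}((v ⊗ w) ⊗ (u ⊗ t))`. -/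
lemma a_mul_a (V W : DiffRep K A) (x : V) (f : Module.Dual K V.carrier) (y : W)
    (g : Module.Dual K W.carrier) :
    a V (x ⊗ₜ f) * a W (y ⊗ₜ g) =
      a (V.tensor W) ((x ⊗ₜ y) ⊗ₜ TensorProduct.dualDistrib K V.carrier W.carrier (f ⊗ₜ g)) := by
  rw [mul_def, mulLin, LinearMap.flip_apply, lift_a, LinearMap.flip_apply, lift_a, mulComp_tmul]

protected lemma mul_comm (x y : Recon K A) : x * y = y * x := by
  induction x using induction with
  | hadd x x' h h' => simp only [mul_def, map_add, LinearMap.add_apply] at h h' ⊢; rw [h, h']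
  | ha V x f =>
    induction y using induction with
    | hadd x x' h h' => simp only [mul_def, map_add, LinearMap.add_apply] at h h' ⊢; rw [h, h']
    | ha W y g =>
      rw [a_mul_a, a_mul_a]
      have := a_rel (DiffRep.Hom.comm V W) (x ⊗ₜ y)
        (TensorProduct.dualDistrib K W.carrier V.carrier (g ⊗ₜ f))
      rw [show (DiffRep.Hom.comm V W).toLin (x ⊗ₜ y) = y ⊗ₜ x from rfl] at this
      rw [← this]
      congr 2
      apply TensorProduct.ext'
      intro x y
      exact _root_.mul_comm _ _

protected lemma mul_assoc (x y z : Recon K A) : x * y * z = x * (y * z) := by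
  induction x using induction with
  | hadd x x' h h' => simp only [mul_def, map_add, LinearMap.add_apply] at h h' ⊢; rw [h, h']
  | ha V x f =>
    induction y using induction with
    | hadd x x' h h' => simp only [mul_def, map_add, LinearMap.add_apply] at h h' ⊢; rw [h, h']
    | ha W y g =>
      induction z using induction with
      | hadd x x' h h' => simp only [mul_def, map_add] at h h' ⊢; rw [h, h']
      | ha X z k =>
        rw [a_mul_a, a_mul_a, a_mul_a, a_mul_a]
        have := a_rel (DiffRep.Hom.assoc V W X) ((x ⊗ₜ y) ⊗ₜ z)
          (TensorProduct.dualDistrib K V.carrier (W.carrier ⊗[K] X.carrier)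
            (f ⊗ₜ TensorProduct.dualDistrib K W.carrier X.carrier (g ⊗ₜ k)))
        rw [show (DiffRep.Hom.assoc V W X).toLin ((x ⊗ₜ y) ⊗ₜ z) = x ⊗ₜ (y ⊗ₜ z) from rfl] at this
        rw [← this]
        congr 2
        apply TensorProduct.ext_threefold
        intro x y z
        exact _root_.mul_assoc _ _ _

protected lemma mul_one (x : Recon K A) : x * 1 = x := by
  induction x using induction with
  | hadd x x' h h' => simp only [mul_def, map_add, LinearMap.add_apply] at h h' ⊢; rw [h, h']
  | ha V x f =>
    rw [one_def, a_mul_a]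
    have := a_rel (DiffRep.Hom.unit V) x
      (TensorProduct.dualDistrib K V.carrier K (f ⊗ₜ (LinearMap.id : K →ₗ[K] K)))
    rw [show (DiffRep.Hom.unit V).toLin x = x ⊗ₜ (1 : K) from rfl] at this
    rw [← this]
    congr 2
    ext y
    exact _root_.mul_one _

instance : CommRing (Recon K A) where
  __ := (inferInstance : AddCommGroup (Recon K A))
  mul := (· * ·)
  one := 1
  mul_assoc := Recon.mul_assoc
  mul_comm := Recon.mul_comm
  mul_one := Recon.mul_one
  one_mul x := by rw [Recon.mul_comm, Recon.mul_one]
  zero_mul x := by simp [mul_def]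
  mul_zero x := by simp [mul_def]
  left_distrib x y z := by simp [mul_def]
  right_distrib x y z := by simp [mul_def]

instance : Algebra K (Recon K A) :=
  Algebra.ofModule (fun c x y => by simp [mul_def]) (fun c x y => by simp [mul_def])

section Derivation

variable [Differential K] [Differential A] [DifferentialAlgebra K A] [DifferentialHopfAlgebra K A]

lemma F_smul (V : DiffRep K A) (c : K) (f : Module.Dual K V.carrier) :
    Prolong.F (c • f) = c • Prolong.F f + c′ • (f ∘ₗ (DiffRep.Hom.proj V).toLin) := by
  apply Prolong.hom_ext
  · intro x
    simp [DiffRep.Hom.proj]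
  · intro x
    simp [DiffRep.Hom.proj, mul_comm]

lemma F_add (V : DiffRep K A) (f g : Module.Dual K V.carrier) :
    Prolong.F (f + g) = Prolong.F f + Prolong.F g := by
  apply Prolong.hom_ext <;> intro x <;> simp

lemma F_comp_incl (V : DiffRep K A) (f : Module.Dual K V.carrier) :
    Prolong.F f ∘ₗ (DiffRep.Hom.incl V).toLin = f := by
  ext x
  simp [DiffRep.Hom.incl]

lemma a_incl (V : DiffRep K A) (x : V) (f : Module.Dual K V.carrier) :
    a V.prolong (Prolong.incl K V.carrier x ⊗ₜ Prolong.F f) = a V (x ⊗ₜ f) := by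
  have := a_rel (DiffRep.Hom.incl V) x (Prolong.F f)
  rw [F_comp_incl] at this
  exact this.symm

lemma a_proj (V : DiffRep K A) (x : V) (f : Module.Dual K V.carrier) :
    a V.prolong (Prolong.d K V.carrier x ⊗ₜ (f ∘ₗ (DiffRep.Hom.proj V).toLin)) = a V (x ⊗ₜ f) := by
  rw [a_rel (DiffRep.Hom.proj V)]
  simp [DiffRep.Hom.proj]

lemma a_d_smul (V : DiffRep K A) (c : K) (x : V) (f : Module.Dual K V.carrier) :
    a V.prolong (Prolong.d K V.carrier (c • x) ⊗ₜ Prolong.F f) =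
      c • a V.prolong (Prolong.d K V.carrier x ⊗ₜ Prolong.F f) + c′ • a V (x ⊗ₜ f) := by
  rw [Prolong.d_smul, TensorProduct.add_tmul, map_add, ← TensorProduct.smul_tmul',
    ← TensorProduct.smul_tmul', map_smul, map_smul, a_incl]

/-- The additive map `V ⊗ V* → 𝒜`, `v ⊗ u ↦ a_{V⁽¹⁾} (∂ v ⊗ F(u))`. -/
def derivComp (V : DiffRep K A) : V.carrier ⊗[K] Module.Dual K V.carrier →+ Recon K A :=
  TensorProduct.liftAddHom
    (AddMonoidHom.mk' (fun x => AddMonoidHom.mk'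
        (fun f => a V.prolong (Prolong.d K V.carrier x ⊗ₜ Prolong.F f))
        (fun f g => by rw [F_add, TensorProduct.tmul_add, map_add]))
      (fun x y => by
        ext f
        simp only [map_add, TensorProduct.add_tmul, AddMonoidHom.mk'_apply,
          AddMonoidHom.add_apply]))
    (fun c x f => by
      simp only [AddMonoidHom.mk'_apply]
      rw [a_d_smul, F_smul, TensorProduct.tmul_add, map_add, TensorProduct.tmul_smul,
        TensorProduct.tmul_smul, map_smul, map_smul, a_proj])

lemma derivComp_tmul (V : DiffRep K A) (x : V) (f : Module.Dual K V.carrier) :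
    derivComp V (x ⊗ₜ f) = a V.prolong (Prolong.d K V.carrier x ⊗ₜ Prolong.F f) := rfl

lemma derivComp_smul (V : DiffRep K A) (c : K) (z : V.carrier ⊗[K] Module.Dual K V.carrier) :
    derivComp V (c • z) = c • derivComp V z + c′ • a V z := by
  induction z with
  | zero => simp
  | add y z hy hz => simp only [smul_add, map_add, hy, hz]; abel
  | tmul x f => rw [TensorProduct.smul_tmul', derivComp_tmul, a_d_smul, derivComp_tmul]

/-- The derivation on the direct sum, with values in `𝒜`. -/
def derivSum : BigSum K A →+ Recon K A := DirectSum.toAddMonoid derivComp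

lemma derivSum_i (V : DiffRep K A) (z : V.carrier ⊗[K] Module.Dual K V.carrier) :
    derivSum (BigSum.i K A V z) = derivComp V z := DirectSum.toAddMonoid_of _ _ _

lemma derivSum_smul (c : K) (z : BigSum K A) :
    derivSum (c • z) = c • derivSum z + c′ • proj z := by
  induction z using DirectSum.induction_on with
  | zero => simp
  | add y z hy hz => simp only [smul_add, map_add, hy, hz]; abel
  | of V z =>
    change derivSum (c • BigSum.i K A V z) = c • derivSum (BigSum.i K A V z) + c′ • a V z
    rw [← map_smul, derivSum_i, derivSum_i, derivComp_smul]

lemma derivSum_relations (z : BigSum K A) (hz : z ∈ relations K A) :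
    (derivSum z : Recon K A) = 0 := by
  induction hz using Submodule.span_induction with
  | zero => simp
  | add x y _ _ hx hy => rw [map_add, hx, hy, add_zero]
  | smul c x hx h =>
    rw [derivSum_smul, h, smul_zero, zero_add,
      show proj x = 0 from (Submodule.Quotient.mk_eq_zero _).2 hx,
      smul_zero]
  | mem x hx =>
    obtain ⟨V, W, φ, z, rfl⟩ := hx
    rw [map_sub, derivSum_i, derivSum_i, sub_eq_zero]
    induction z with
    | zero => simp
    | add y z hy hz => simp only [map_add, hy, hz]
    | tmul x t =>
      change a V.prolong (Prolong.d K V.carrier x ⊗ₜ Prolong.F (t ∘ₗ φ.toLin)) =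
        a W.prolong (Prolong.d K W.carrier (φ.toLin x) ⊗ₜ Prolong.F t)
      have h1 : Prolong.F (t ∘ₗ φ.toLin) = Prolong.F t ∘ₗ φ.prolong.toLin := by
        apply Prolong.hom_ext <;> intro x <;> simp [DiffRep.Hom.prolong]
      rw [h1, a_rel φ.prolong]
      congr 2
      simp [DiffRep.Hom.prolong]

/-- The additive map underlying the derivation of `𝒜`. -/
def derivAdd : Recon K A →+ Recon K A :=
  QuotientAddGroup.lift (relations K A).toAddSubgroup derivSum derivSum_relations

lemma derivAdd_a (V : DiffRep K A) (x : V) (f : Module.Dual K V.carrier) :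
    derivAdd (a V (x ⊗ₜ f)) = a V.prolong (Prolong.d K V.carrier x ⊗ₜ Prolong.F f) :=
  derivSum_i V (x ⊗ₜ f)

lemma derivAdd_smul (c : K) (z : Recon K A) :
    derivAdd (c • z) = c • derivAdd z + c′ • z := by
  obtain ⟨z, rfl⟩ := (relations K A).mkQ_surjective z
  exact derivSum_smul c z

lemma derivAdd_mul (x y : Recon K A) :
    derivAdd (x * y) = x * derivAdd y + y * derivAdd x := by
  induction x using induction with
  | hadd x x' h h' => simp only [add_mul, mul_add, map_add, h, h']; abel
  | ha V x f =>
    induction y using induction with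
    | hadd x x' h h' => simp only [add_mul, mul_add, map_add, h, h']; abel
    | ha W y g =>
      have hF : Prolong.F (TensorProduct.dualDistrib K V.carrier W.carrier (f ⊗ₜ g)) =
          TensorProduct.dualDistrib K (Prolong K V.carrier) (Prolong K W.carrier)
            (Prolong.F f ⊗ₜ Prolong.F g) ∘ₗ (DiffRep.Hom.leibniz V W).toLin := by
        apply Prolong.hom_ext
        · intro z
          induction z with
          | zero => simp
          | add y z hy hz => simp only [map_add, hy, hz]
          | tmul x y => simp [DiffRep.Hom.leibniz]
        · intro z
          induction z with
          | zero => simp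
          | add y z hy hz => simp only [map_add, hy, hz]
          | tmul x y => simp [DiffRep.Hom.leibniz, mul_comm, add_comm]
      have hd : (DiffRep.Hom.leibniz V W).toLin
          (Prolong.d K (V.carrier ⊗[K] W.carrier) (x ⊗ₜ[K] y)) =
          Prolong.d K V.carrier x ⊗ₜ[K] Prolong.incl K W.carrier y +
          Prolong.incl K V.carrier x ⊗ₜ[K] Prolong.d K W.carrier y := by
        simp [DiffRep.Hom.leibniz]
      rw [a_mul_a, derivAdd_a, hF, a_rel (DiffRep.Hom.leibniz V W), hd, TensorProduct.add_tmul,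
        map_add, derivAdd_a, derivAdd_a, ← a_incl V x f, ← a_incl W y g]
      rw [← a_mul_a V.prolong W.prolong, ← a_mul_a V.prolong W.prolong, add_comm,
        mul_comm (a W.prolong _)]

/-- The derivation of `𝒜`; see `deriv_a`. -/
instance : Differential (Recon K A) where
  deriv := Derivation.mk' derivAdd.toIntLinearMap derivAdd_mul

/-- `(a_V(v ⊗ u))′ = a_{V⁽¹⁾}(∂ v ⊗ F(u))`. -/
lemma deriv_a (V : DiffRep K A) (x : V) (f : Module.Dual K V.carrier) :
    (a V (x ⊗ₜ f))′ = a V.prolong (Prolong.d K V.carrier x ⊗ₜ Prolong.F f) :=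
  derivAdd_a V x f

instance : DifferentialAlgebra K (Recon K A) where
  deriv_algebraMap c := by
    have h : derivAdd (1 : Recon K A) = 0 := by
      have := derivAdd_mul (1 : Recon K A) 1
      simpa using this
    change derivAdd (algebraMap K (Recon K A) c) = _
    rw [Algebra.algebraMap_eq_smul_one, derivAdd_smul, h, smul_zero, zero_add,
      Algebra.algebraMap_eq_smul_one]

end Derivation

end Recon

end Recon

end DiffTannaka

end

open DiffTannaka

/-! Matrix coefficients are natural in the representation (`psi_hom`), so $a_V(v\otimes
u)\mapsto\psi_V(v\otimes u)$ is a well-defined linear map $\mathcal A\to A$. The main point is that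
it is bijective; the Hopf structure of $A$ can then be carried back to $\mathcal A$.

Bijectivity rests on local finiteness: every finite-dimensional subspace of $A$ lies in a
finite-dimensional subcomodule $D\subseteq A$ (`exists_diffRep_le_range`), where $A$ coacts on
itself by $\Delta$. If $y\in D$, the counit axiom gives $y=\psi_D(y\otimes\varepsilon|_D)$, hence
surjectivity. For injectivity, fix $u\in V^*$. The map $v\mapsto\psi_V(v\otimes u)$ is a comodule
morphism $V\to A$ that pulls $\varepsilon$ back to $u$. If $D$ contains its image, the relations of
$\mathcal A$ give $a_V(v\otimes u)=a_D(\psi_V(v\otimes u)\otimes\varepsilon|_D)$. With one $D$ large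
enough for two representations (`exists_common_diffRep`), a sum of two classes is again a single
class, and two classes with the same coefficient coincide.

The map respects products and derivations by `psi_tensor` and `psi_prolong`. The maps
$\tilde\Delta,\tilde\varepsilon,\tilde S$ are defined by transport along this isomorphism, so they
are well defined and satisfy the Hopf axioms because $\Delta,\varepsilon,S$ do. Their formulas on
classes are `comul_psi`, `counit_psi` and `psi_dual` read through the isomorphism. -/

noncomputable section

namespace DiffTannaka

/-! ### Local finiteness of the regular comodule -/

section LocalFiniteness

variable {K : Type u} {A : Type v} [Field K] [CommRing A]

/-- The contraction `V ⊗ A → V` with a functional on the right factor. -/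
def contractRight [Algebra K A] {V : Type w} [AddCommGroup V] [Module K V]
    (θ : Module.Dual K A) : V ⊗[K] A →ₗ[K] V :=
  (TensorProduct.rid K V).toLinearMap ∘ₗ θ.lTensor V

@[simp] lemma contractRight_tmul [Algebra K A] {V : Type w} [AddCommGroup V] [Module K V]
    (θ : Module.Dual K A) (x : V) (y : A) : contractRight θ (x ⊗ₜ[K] y) = θ y • x := by
  simp [contractRight]

/-- A tensor all of whose right contractions lie in the image of `e` lies in the image of
`e ⊗ id`. -/
lemma mem_range_rTensor_of_contractRight [Algebra K A] {V W : Type*} [AddCommGroup V] [Module K V]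
    [AddCommGroup W] [Module K W] (e : W →ₗ[K] V) (z : V ⊗[K] A)
    (h : ∀ θ : Module.Dual K A, contractRight θ z ∈ LinearMap.range e) :
    z ∈ LinearMap.range (e.rTensor A) := by
  classical
  let b := Module.Free.chooseBasis K A
  -- The basis of $A$ may be infinite, so a tensor is expanded over a finite set of indices.
  -- Allowing every larger set `t` lets the expansions of two summands be taken over the same set.
  have key : ∀ z : V ⊗[K] A, ∃ s : Finset _,
      ∀ t, s ⊆ t → z = ∑ i ∈ t, contractRight (b.coord i) z ⊗ₜ[K] b i := by
    intro z
    induction z with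
    | zero => exact ⟨∅, by simp⟩
    | add y z hy hz =>
      obtain ⟨s, hs⟩ := hy
      obtain ⟨s', hs'⟩ := hz
      refine ⟨s ∪ s', fun t ht => ?_⟩
      conv_lhs => rw [hs t (Finset.union_subset_left ht), hs' t (Finset.union_subset_right ht)]
      simp only [map_add, TensorProduct.add_tmul, Finset.sum_add_distrib]
    | tmul x a =>
      refine ⟨(b.repr a).support, fun t ht => ?_⟩
      conv_lhs => rw [← b.linearCombination_repr a, Finsupp.linearCombination_apply,
        Finsupp.sum_of_support_subset _ ht _ (by simp), TensorProduct.tmul_sum]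
      exact Finset.sum_congr rfl fun i _ => by simp [TensorProduct.smul_tmul]
  obtain ⟨s, hs⟩ := key z
  rw [hs s subset_rfl]
  refine sum_mem fun i _ => ?_
  obtain ⟨w, hw⟩ := h (b.coord i)
  exact ⟨w ⊗ₜ b i, by simp [hw]⟩

variable [HopfAlgebra K A]

/-- Coassociativity: in Sweedler notation both sides are $\sum y_{(1)}\theta(y_{(2)})\eta(y_{(3)})$.
Thus contractions of $\Delta$ compose through the convolution product of functionals, which is what
makes the span of contractions stable. -/
lemma contractRight_contractRight_comul (θ η : Module.Dual K A) (y : A) :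
    contractRight θ (Coalgebra.comul (R := K) (contractRight η (Coalgebra.comul (R := K) y))) =
      contractRight (LinearMap.mul' K K ∘ₗ TensorProduct.map θ η ∘ₗ Coalgebra.comul)
        (Coalgebra.comul (R := K) y) := by
  -- Stated for an arbitrary tensor so that induction applies; at $z=\Delta y$ the right side
  -- contains $(\Delta\otimes\mathrm{id})\Delta y$, ready for coassociativity.
  have h1 : ∀ z : A ⊗[K] A, contractRight θ (Coalgebra.comul (R := K) (contractRight η z)) =
      TensorProduct.rid K A ((LinearMap.mul' K K ∘ₗ TensorProduct.map θ η).lTensor A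
        (TensorProduct.assoc K A A A ((Coalgebra.comul (R := K)).rTensor A z))) := by
    intro z
    induction z with
    | zero => simp
    | add y z hy hz => simp only [map_add, hy, hz]
    | tmul x y =>
      simp only [contractRight_tmul, map_smul, LinearMap.rTensor_tmul]
      induction Coalgebra.comul (R := K) x with
      | zero => simp
      | add y z hy hz => simp only [map_add, smul_add, TensorProduct.add_tmul, hy, hz]
      | tmul p q => simp [smul_smul, mul_comm]
  rw [h1, Coalgebra.coassoc_apply, ← LinearMap.comp_apply (LinearMap.lTensor A _),
    ← LinearMap.lTensor_comp]
  rfl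

/-- The subcomodule generated by a subspace of `A`. -/
def generatedSubcomodule (U : Submodule K A) : Submodule K A :=
  Submodule.span K {y | ∃ x ∈ U, ∃ θ : Module.Dual K A,
    y = contractRight θ (Coalgebra.comul (R := K) x)}

/-- Contracting $\Delta x$ with the counit gives back $x$. -/
lemma le_generatedSubcomodule (U : Submodule K A) : U ≤ generatedSubcomodule U := by
  intro x hx
  refine Submodule.subset_span ⟨x, hx, Coalgebra.counit, ?_⟩
  rw [contractRight, LinearMap.comp_apply, Coalgebra.lTensor_counit_comul]
  simp

/-- All right contractions of one tensor lie in the span of its finitely many left factors, whatever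
the functional. By linearity it suffices to collect these spans for $\Delta$ of a basis of `U`. -/
instance finite_generatedSubcomodule (U : Submodule K A) [Module.Finite K U] :
    Module.Finite K (generatedSubcomodule U) := by
  have h : ∀ z : A ⊗[K] A, ∃ T : Submodule K A, T.FG ∧
      ∀ θ : Module.Dual K A, contractRight θ z ∈ T := by
    intro z
    induction z with
    | zero => exact ⟨⊥, Submodule.fg_bot, by simp⟩
    | add y z hy hz =>
      obtain ⟨S, hS, h⟩ := hy
      obtain ⟨T, hT, h'⟩ := hz
      refine ⟨S ⊔ T, hS.sup hT, fun θ => ?_⟩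
      rw [map_add]
      exact Submodule.add_mem_sup (h θ) (h' θ)
    | tmul x y =>
      refine ⟨K ∙ x, Submodule.fg_span_singleton x, fun θ => ?_⟩
      rw [contractRight_tmul]
      exact Submodule.smul_mem _ _ (Submodule.mem_span_singleton_self x)
  choose T hT h using h
  let b := Module.finBasis K U
  refine Module.Finite.of_fg (Submodule.FG.of_le (Submodule.fg_iSup _
    fun i => hT (Coalgebra.comul (R := K) (b i : A))) ?_)
  refine Submodule.span_le.2 ?_
  rintro _ ⟨x, hx, θ, rfl⟩
  have hx' : x = ∑ i, b.repr ⟨x, hx⟩ i • (b i : A) := by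
    have := congrArg Subtype.val (b.sum_repr ⟨x, hx⟩)
    rw [Submodule.coe_sum] at this
    exact this.symm
  rw [hx']
  simp only [map_sum, map_smul]
  exact sum_mem fun i _ => Submodule.smul_mem _ _ (Submodule.mem_iSup_of_mem i (h _ θ))

/-- A contraction of a generator is again a generator, for the convolved functional. Together with
`mem_range_rTensor_of_contractRight` this gives $\Delta(C)\subseteq C\otimes A$ for the generated
subspace $C$. -/
lemma contractRight_comul_mem (U : Submodule K A) {x : A} (hx : x ∈ generatedSubcomodule U)
    (θ : Module.Dual K A) :
    contractRight θ (Coalgebra.comul (R := K) x) ∈ generatedSubcomodule U := by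
  induction hx using Submodule.span_induction with
  | zero => simp
  | add x y _ _ hx hy => simpa only [map_add] using add_mem hx hy
  | smul c x _ hx => simpa only [map_smul] using Submodule.smul_mem _ _ hx
  | mem x hx =>
    obtain ⟨y, hy, η, rfl⟩ := hx
    rw [contractRight_contractRight_comul]
    exact Submodule.subset_span ⟨y, hy, _, rfl⟩

/-- An injective map from a finite-dimensional space into `A` whose image is a subcomodule makes
its source a representation. -/
lemma exists_diffRep_of_injective {V : Type u} [AddCommGroup V] [Module K V] [Module.Finite K V]
    (e : V →ₗ[K] A) (he : Function.Injective e)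
    (h : ∀ x, Coalgebra.comul (R := K) (e x) ∈ LinearMap.range (e.rTensor A)) :
    ∃ (D : DiffRep K A) (j : D.carrier →ₗ[K] A), Function.Injective j ∧
      LinearMap.range j = LinearMap.range e ∧
      Coalgebra.comul ∘ₗ j = j.rTensor A ∘ₗ D.ρ := by
  -- Over a field tensoring preserves injectivity. The factor `A` serves to define the coaction; `A
  -- ⊗ A` and `K` serve to check coassociativity and counit after embedding, where they become the
  -- axioms of $A$.
  have he1 := Module.Flat.rTensor_preserves_injective_linearMap (M := A) e he
  have he2 := Module.Flat.rTensor_preserves_injective_linearMap (M := A ⊗[K] A) e he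
  have he3 := Module.Flat.rTensor_preserves_injective_linearMap (M := K) e he
  let ρ : V →ₗ[K] V ⊗[K] A := (LinearEquiv.ofInjective (e.rTensor A) he1).symm.toLinearMap ∘ₗ
    LinearMap.codRestrict _ (Coalgebra.comul ∘ₗ e) h
  have hρ : ∀ x, e.rTensor A (ρ x) = Coalgebra.comul (R := K) (e x) := fun x =>
    congrArg Subtype.val ((LinearEquiv.ofInjective (e.rTensor A) he1).apply_symm_apply
      ⟨Coalgebra.comul (R := K) (e x), h x⟩)
  refine ⟨{ carrier := V, ρ := ρ, coassoc := ?_, counit := ?_ }, e, he, rfl,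
    LinearMap.ext fun x => (hρ x).symm⟩
  · ext x
    apply he2
    have h1 : ∀ z : V ⊗[K] A, e.rTensor (A ⊗[K] A) (TensorProduct.assoc K V A A (ρ.rTensor A z)) =
        TensorProduct.assoc K A A A ((Coalgebra.comul (R := K)).rTensor A (e.rTensor A z)) := by
      intro z
      induction z with
      | zero => simp
      | add y z hy hz => simp only [map_add, hy, hz]
      | tmul y a =>
        simp only [LinearMap.rTensor_tmul, ← hρ]
        induction ρ y with
        | zero => simp
        | add y z hy hz => simp only [map_add, TensorProduct.add_tmul, hy, hz]
        | tmul y a => simp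
    have h2 : ∀ z : V ⊗[K] A, e.rTensor (A ⊗[K] A) ((Coalgebra.comul (R := K)).lTensor V z) =
        (Coalgebra.comul (R := K)).lTensor A (e.rTensor A z) := by
      intro z
      induction z with
      | zero => simp
      | add y z hy hz => simp only [map_add, hy, hz]
      | tmul y a => simp
    simp only [LinearMap.comp_apply, LinearEquiv.coe_coe]
    rw [h1, h2, hρ, Coalgebra.coassoc_apply]
  · ext x
    apply he3
    have h2 : ∀ z : V ⊗[K] A, e.rTensor K ((Coalgebra.counit (R := K)).lTensor V z) =
        (Coalgebra.counit (R := K)).lTensor A (e.rTensor A z) := by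
      intro z
      induction z with
      | zero => simp
      | add y z hy hz => simp only [map_add, hy, hz]
      | tmul y a => simp
    simp only [LinearMap.comp_apply]
    rw [h2, hρ, Coalgebra.lTensor_counit_comul]
    simp

/-- Every finite-dimensional subspace of `A` is contained in a finite-dimensional subcomodule. -/
lemma exists_diffRep_le_range (U : Submodule K A) [Module.Finite K U] :
    ∃ (D : DiffRep K A) (j : D.carrier →ₗ[K] A), Function.Injective j ∧ U ≤ LinearMap.range j ∧
      Coalgebra.comul ∘ₗ j = j.rTensor A ∘ₗ D.ρ := by
  let C := generatedSubcomodule U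
  -- The carrier of a `DiffRep` must live in the universe of `K`, while `C` lives in that of `A`;
  -- hence the coordinate space in place of `C`.
  let e : (Fin (Module.finrank K C) → K) →ₗ[K] A :=
    C.subtype ∘ₗ (Module.finBasis K C).equivFun.symm.toLinearMap
  have hr : LinearMap.range e = C := by
    rw [LinearMap.range_comp, LinearEquiv.range, Submodule.map_top, Submodule.range_subtype]
  obtain ⟨D, j, hj, hj', hc⟩ := exists_diffRep_of_injective e
    (C.injective_subtype.comp (LinearEquiv.injective _)) (fun x =>
      mem_range_rTensor_of_contractRight e _ fun θ => by
        have hx : e x ∈ C := hr.le (LinearMap.mem_range_self e x)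
        rw [hr]
        exact contractRight_comul_mem U hx θ)
  exact ⟨D, j, hj, by rw [hj', hr]; exact le_generatedSubcomodule U, hc⟩

end LocalFiniteness

/-! ### Matrix coefficients under the operations on representations -/

section Coefficients

variable {K : Type u} {A : Type v} [Field K] [CommRing A] [HopfAlgebra K A]

/-- The matrix coefficients as a linear map `V ⊗ V* → A`. -/
def psiLin (V : DiffRep K A) : V.carrier ⊗[K] Module.Dual K V.carrier →ₗ[K] A :=
  TensorProduct.lift (LinearMap.mk₂ K (psi V)
    (fun x y f => by simp [psi]) (fun c x f => by simp [psi])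
    (fun x f g => by simp [psi, contract, LinearMap.rTensor_add])
    (fun c x f => by simp [psi, contract, LinearMap.rTensor_smul]))

@[simp] lemma psiLin_tmul (V : DiffRep K A) (x : V) (f : Module.Dual K V) :
    psiLin V (x ⊗ₜ f) = psi V x f := rfl

/-- The map `x ↦ ψ_V(x ⊗ u)` is a morphism of comodules from `V` to `A`. -/
lemma comul_comp_psiLin_flip (V : DiffRep K A) (f : Module.Dual K V) :
    Coalgebra.comul ∘ₗ (psiLin V ∘ₗ (TensorProduct.mk K _ _).flip f) =
      (psiLin V ∘ₗ (TensorProduct.mk K _ _).flip f).rTensor A ∘ₗ V.ρ := by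
  ext x
  let b := Module.finBasis K V
  simp only [LinearMap.comp_apply, LinearMap.flip_apply, TensorProduct.mk_apply, psiLin_tmul]
  -- Both sides become $\sum_i\psi_V(b_i\otimes u)\otimes\psi_V(x\otimes b_i^*)$.
  rw [comul_psi V b, rho_basis V b]
  simp

/-- Equivariance of `φ`, contracted with `t`. It says that the coefficient maps kill the relations
defining $\mathcal A$. -/
lemma psi_hom {V W : DiffRep K A} (φ : DiffRep.Hom V W) (x : V) (t : Module.Dual K W) :
    psi V x (t ∘ₗ φ.toLin) = psi W (φ.toLin x) t := by
  rw [psi, psi, φ.apply, contract, contract, LinearMap.rTensor_comp]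
  rfl

lemma psi_triv : psi (DiffRep.triv K A) (1 : K) (LinearMap.id : K →ₗ[K] K) = 1 := by
  change contract (LinearMap.id : K →ₗ[K] K) ((1 : K) ⊗ₜ[K] (1 : A)) = 1
  simp

/-- The coaction on a tensor product multiplies the components in $A$. This is what makes $\mathcal
A\to A$ multiplicative. -/
lemma psi_tensor (V W : DiffRep K A) (x : V) (f : Module.Dual K V) (y : W)
    (g : Module.Dual K W) :
    psi (V.tensor W) (x ⊗ₜ y) (TensorProduct.dualDistrib K V.carrier W.carrier (f ⊗ₜ g)) =
      psi V x f * psi W y g := by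
  change contract _ (mulT (V.ρ x) (W.ρ y)) = contract f (V.ρ x) * contract g (W.ρ y)
  induction V.ρ x with
  | zero => simp [zero_mulT]
  | add y z hy hz => simp only [add_mulT, map_add, add_mul, hy, hz]
  | tmul p r =>
    induction W.ρ y with
    | zero => simp [mulT_zero]
    | add y z hy hz => simp only [mulT_add, map_add, mul_add, hy, hz]
    | tmul q s => simp [mulT_tmul, smul_smul, mul_comm]

/-- The dual coaction is $u\mapsto\sum_i b_i^*\otimes S\psi_V(b_i\otimes u)$, and evaluation at $x$
reassembles $x$ from its coordinates. This yields the formula for $\tilde S$. -/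
lemma psi_dual (V : DiffRep K A) (x : V) (f : Module.Dual K V) :
    psi V.dual f (Module.Dual.eval K V x) = HopfAlgebra.antipode K (psi V x f) := by
  let b := Module.finBasis K V
  change contract (Module.Dual.eval K V x) (dualρ V f) = _
  rw [dualρ_basis V b]
  conv_rhs => rw [← b.sum_repr x]
  simp only [psi, map_sum, map_smul, contract_tmul, Module.Dual.eval_apply,
    Module.Basis.coord_apply]

/-- If $\rho(x)=\sum x_i\otimes a_i$, then $F(u)$ contracts $\sum(\partial x_i\otimes
a_i+x_i\otimes\partial a_i)$ to $\sum\bigl(\partial(u(x_i))a_i+u(x_i)\partial a_i\bigr)$, which is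
the Leibniz expansion of $\partial\sum u(x_i)a_i$. -/
lemma psi_prolong [Differential K] [Differential A] [DifferentialAlgebra K A]
    [DifferentialHopfAlgebra K A] (V : DiffRep K A) (x : V) (f : Module.Dual K V) :
    psi V.prolong (Prolong.d K V.carrier x) (Prolong.F f) = (psi V x f)′ := by
  change contract _ (prolongρ V (Prolong.d K V.carrier x)) = _
  rw [prolongρ_d, psi]
  induction V.ρ x with
  | zero => simp
  | add y z hy hz => simp only [map_add, hy, hz]
  | tmul p r => simp [deriv_smul, add_comm]

end Coefficients

/-! ### Reduction to subcomodules of $A$, and the isomorphism $\mathcal A\cong A$ -/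

section Factorization

variable {K : Type u} {A : Type v} [Field K] [CommRing A] [HopfAlgebra K A]

/-- A morphism of comodules `V → A` with values in an embedded representation `D ⊆ A` factors
through `D`. -/
lemma exists_hom_factor {V D : DiffRep K A} (j : D.carrier →ₗ[K] A) (hj : Function.Injective j)
    (hc : Coalgebra.comul ∘ₗ j = j.rTensor A ∘ₗ D.ρ) (k : V.carrier →ₗ[K] A)
    (hk : Coalgebra.comul ∘ₗ k = k.rTensor A ∘ₗ V.ρ)
    (hkj : LinearMap.range k ≤ LinearMap.range j) :
    ∃ φ : DiffRep.Hom V D, j ∘ₗ φ.toLin = k := by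
  let l : V.carrier →ₗ[K] D.carrier := (LinearEquiv.ofInjective j hj).symm.toLinearMap ∘ₗ
    LinearMap.codRestrict _ k fun x => hkj (LinearMap.mem_range_self k x)
  have hl : j ∘ₗ l = k := LinearMap.ext fun x =>
    congrArg Subtype.val ((LinearEquiv.ofInjective j hj).apply_symm_apply
      ⟨k x, hkj (LinearMap.mem_range_self k x)⟩)
  refine ⟨⟨l, LinearMap.ext fun x => ?_⟩, hl⟩
  -- Equivariance may be tested after the injection $j\otimes\mathrm{id}$, where both sides equal
  -- $\Delta(k(x))$.
  apply Module.Flat.rTensor_preserves_injective_linearMap (M := A) j hj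
  have h1 := LinearMap.congr_fun hc (l x)
  have h2 := LinearMap.congr_fun hk x
  rw [← hl, LinearMap.rTensor_comp] at h2
  exact h1.symm.trans h2

namespace Recon

/-- Any two classes `a_V(x ⊗ f)`, `a_W(y ⊗ g)` come from one representation `D ⊆ A`
together with the restriction of the counit. -/
lemma exists_common_diffRep (V W : DiffRep K A) (f : Module.Dual K V) (g : Module.Dual K W) :
    ∃ (D : DiffRep K A) (t : Module.Dual K D) (φ : V →ₗ[K] D) (χ : W →ₗ[K] D),
      (∀ x, a V (x ⊗ₜ f) = a D (φ x ⊗ₜ t)) ∧ (∀ y, a W (y ⊗ₜ g) = a D (χ y ⊗ₜ t)) ∧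
      ∀ x y, psi V x f = psi W y g → φ x = χ y := by
  let k : V.carrier →ₗ[K] A := psiLin V ∘ₗ (TensorProduct.mk K _ _).flip f
  let l : W.carrier →ₗ[K] A := psiLin W ∘ₗ (TensorProduct.mk K _ _).flip g
  -- One `D` receives the coefficient maps of both representations, so the two classes become
  -- comparable inside `D`.
  obtain ⟨D, j, hj, hU, hc⟩ := exists_diffRep_le_range (LinearMap.range k ⊔ LinearMap.range l)
  obtain ⟨φ, hφ⟩ := exists_hom_factor j hj hc k (comul_comp_psiLin_flip V f)
    (le_sup_left.trans hU)
  obtain ⟨χ, hχ⟩ := exists_hom_factor j hj hc l (comul_comp_psiLin_flip W g)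
    (le_sup_right.trans hU)
  have hφ' : ∀ x, j (φ.toLin x) = psi V x f := LinearMap.congr_fun hφ
  have hχ' : ∀ y, j (χ.toLin y) = psi W y g := LinearMap.congr_fun hχ
  -- The counit works as the common functional because $\varepsilon(\psi_V(x\otimes f))=f(x)$: it
  -- pulls back to `f` along `φ` and to `g` along `χ`.
  refine ⟨D, Coalgebra.counit ∘ₗ j, φ.toLin, χ.toLin, fun x => ?_, fun y => ?_,
    fun x y h => hj ?_⟩
  · rw [← a_rel]
    congr 2
    ext x
    simp [hφ', counit_psi]
  · rw [← a_rel]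
    congr 2
    ext y
    simp [hχ', counit_psi]
  · rw [hφ', hχ', h]

/-- Two classes moved to a common `D` carry the same functional `t`, so their sum is the class of
one pure tensor. -/
lemma exists_eq_a (z : Recon K A) :
    ∃ (V : DiffRep K A) (x : V) (f : Module.Dual K V), z = a V (x ⊗ₜ f) := by
  induction z using induction with
  | ha V x f => exact ⟨V, x, f, rfl⟩
  | hadd y z hy hz =>
    obtain ⟨V, x, f, rfl⟩ := hy
    obtain ⟨W, y, g, rfl⟩ := hz
    obtain ⟨D, t, φ, χ, h, h', -⟩ := exists_common_diffRep V W f g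
    exact ⟨D, φ x + χ y, t, by rw [h, h', TensorProduct.add_tmul, map_add]⟩

/-- The linear map `𝒜 → A`, `a_V(v ⊗ u) ↦ ψ_V(v ⊗ u)`. -/
def toCoordLin : Recon K A →ₗ[K] A := lift psiLin fun _ _ φ x t => psi_hom φ x t

@[simp] lemma toCoordLin_a (V : DiffRep K A) (x : V) (f : Module.Dual K V) :
    toCoordLin (a V (x ⊗ₜ f)) = psi V x f := lift_a _ _ _ _

/-- Inside a common `D` with a common functional, each class is determined by a vector of `D`, and
equal coefficients force equal vectors. -/
lemma toCoordLin_injective : Function.Injective (toCoordLin (K := K) (A := A)) := by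
  intro y z h
  obtain ⟨V, x, f, rfl⟩ := exists_eq_a y
  obtain ⟨W, y, g, rfl⟩ := exists_eq_a z
  obtain ⟨D, t, φ, χ, h1, h2, h3⟩ := exists_common_diffRep V W f g
  rw [h1, h2, h3 x y (by simpa using h)]

/-- For $y=j(x)$ in a subcomodule, the coefficient of $x$ against $\varepsilon\circ j$ is
$(\varepsilon\otimes\mathrm{id})\Delta(y)=y$. -/
lemma toCoordLin_surjective : Function.Surjective (toCoordLin (K := K) (A := A)) := by
  intro y
  obtain ⟨D, j, hj, hU, hc⟩ := exists_diffRep_le_range (K ∙ y)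
  obtain ⟨x, rfl⟩ := hU (Submodule.mem_span_singleton_self y)
  refine ⟨a D (x ⊗ₜ (Coalgebra.counit ∘ₗ j)), ?_⟩
  have h := congrArg (contract (Coalgebra.counit (R := K))) (LinearMap.congr_fun hc x)
  rw [toCoordLin_a, psi, contract, LinearMap.rTensor_comp]
  simp only [contract, LinearMap.comp_apply, LinearEquiv.coe_coe,
    Coalgebra.rTensor_counit_comul] at h ⊢
  rw [← h]
  simp

/-- The isomorphism of algebras `𝒜 ≃ A`, `a_V(v ⊗ u) ↦ ψ_V(v ⊗ u)`. -/
def equivCoord : Recon K A ≃ₐ[K] A :=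
  AlgEquiv.ofBijective (AlgHom.ofLinearMap toCoordLin
    (by rw [one_def, toCoordLin_a, psi_triv])
    (fun x y => by
      obtain ⟨V, x, f, rfl⟩ := exists_eq_a x
      obtain ⟨W, y, g, rfl⟩ := exists_eq_a y
      rw [a_mul_a, toCoordLin_a, toCoordLin_a, toCoordLin_a, psi_tensor]))
    ⟨toCoordLin_injective, toCoordLin_surjective⟩

@[simp] lemma equivCoord_a (V : DiffRep K A) (x : V) (f : Module.Dual K V) :
    equivCoord (a V (x ⊗ₜ f)) = psi V x f := toCoordLin_a V x f

lemma equivCoord_deriv [Differential K] [Differential A] [DifferentialAlgebra K A]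
    [DifferentialHopfAlgebra K A] (x : Recon K A) : equivCoord (x′) = (equivCoord x)′ := by
  obtain ⟨V, x, f, rfl⟩ := exists_eq_a x
  rw [deriv_a, equivCoord_a, equivCoord_a, psi_prolong]

end Recon

end Factorization

/-! ### Transport of the differential Hopf structure along an isomorphism -/

section Transport

variable {K : Type u} {A : Type v} {B : Type w} [Field K] [CommRing A] [HopfAlgebra K A]
  [CommRing B] [Algebra K B] (Φ : B ≃ₐ[K] A)

/-- The comultiplication transported along an isomorphism. -/
def transportComul : B →ₐ[K] B ⊗[K] B :=
  (Algebra.TensorProduct.map Φ.symm.toAlgHom Φ.symm.toAlgHom).comp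
    ((Bialgebra.comulAlgHom K A).comp Φ.toAlgHom)

/-- The counit transported along an isomorphism. -/
def transportCounit : B →ₐ[K] K := (Bialgebra.counitAlgHom K A).comp Φ.toAlgHom

/-- The antipode transported along an isomorphism. -/
def transportAntipode : B →ₐ[K] B :=
  Φ.symm.toAlgHom.comp ((HopfAlgebra.antipodeAlgHom K A).comp Φ.toAlgHom)

lemma transportComul_apply (x : B) : transportComul Φ x =
    TensorProduct.map Φ.symm.toLinearMap Φ.symm.toLinearMap (Coalgebra.comul (R := K) (Φ x)) := rfl

lemma transportCounit_apply (x : B) : transportCounit Φ x = Coalgebra.counit (R := K) (Φ x) := rfl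

lemma transportAntipode_apply (x : B) :
    transportAntipode Φ x = Φ.symm (HopfAlgebra.antipode K (Φ x)) := rfl

lemma map_transportComul (x : B) :
    TensorProduct.map Φ.toLinearMap Φ.toLinearMap (transportComul Φ x) =
      Coalgebra.comul (R := K) (Φ x) := by
  rw [transportComul_apply, ← LinearMap.comp_apply, ← TensorProduct.map_comp]
  have : Φ.toLinearMap ∘ₗ Φ.symm.toLinearMap = LinearMap.id := by ext; simp
  rw [this, TensorProduct.map_id, LinearMap.id_apply]

/-- Each axiom is the corresponding one of $A$ at $\Phi(x)$, pulled back by $\Phi^{-1}$. The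
comparisons hold for any tensor in place of $\Delta(\Phi(x))$, hence the inductions. -/
lemma isDifferentialHopf_transport [Differential K] [Differential A] [DifferentialAlgebra K A]
    [Differential B] [DifferentialAlgebra K B] [hA : DifferentialHopfAlgebra K A]
    (hΦ : ∀ x, Φ (x′) = (Φ x)′) :
    IsDifferentialHopf (transportComul Φ) (transportCounit Φ) (transportAntipode Φ) := by
  have hΦ' : ∀ x, Φ.symm (x′) = (Φ.symm x)′ := fun x => by
    rw [AlgEquiv.symm_apply_eq, hΦ, AlgEquiv.apply_symm_apply]
  have hA := hA.isDifferentialHopf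
  constructor
  · intro x
    rw [transportComul_apply, transportComul_apply, hΦ]
    refine Eq.trans ?_ (congrArg _ (hA.deriv_comul (Φ x)))
    change _ = TensorProduct.map _ _ ((Coalgebra.comul (R := K) (Φ x))′)
    induction Coalgebra.comul (R := K) (Φ x) with
    | zero => simp
    | add y z hy hz => simp only [map_add, hy, hz]
    | tmul p q => simp [hΦ']
  · intro x
    rw [transportCounit_apply, transportCounit_apply, hΦ]
    exact hA.deriv_counit (Φ x)
  · intro x
    rw [transportAntipode_apply, transportAntipode_apply, hΦ, ← hΦ']
    exact congrArg Φ.symm (hA.deriv_antipode (Φ x))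
  · intro x
    -- Coassociativity in $A$ is pulled back to triple tensors over `B`; the two remaining goals
    -- match its sides with those required.
    have h := congrArg (TensorProduct.map Φ.symm.toLinearMap
      (TensorProduct.map Φ.symm.toLinearMap Φ.symm.toLinearMap)) (hA.coassoc (Φ x))
    refine Eq.trans ?_ (h.trans ?_)
    · rw [transportComul_apply]
      change _ = TensorProduct.map _ _ (TensorProduct.assoc K A A A
        ((Bialgebra.comulAlgHom K A).toLinearMap.rTensor A (Coalgebra.comul (R := K) (Φ x))))
      induction Coalgebra.comul (R := K) (Φ x) with
      | zero => simp
      | add y z hy hz => simp only [map_add, hy, hz]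
      | tmul p q =>
        simp only [TensorProduct.map_tmul, LinearMap.rTensor_tmul, AlgHom.toLinearMap_apply,
          transportComul_apply, AlgEquiv.toLinearMap_apply, AlgEquiv.apply_symm_apply,
          Bialgebra.comulAlgHom_apply]
        -- A second induction is needed since $\Delta(p)$ is itself a sum of pure tensors.
        induction Coalgebra.comul (R := K) p with
        | zero => simp
        | add y z hy hz => simp only [map_add, TensorProduct.add_tmul, hy, hz]
        | tmul r s => simp
    · rw [transportComul_apply]
      change TensorProduct.map _ _
        ((Bialgebra.comulAlgHom K A).toLinearMap.lTensor A (Coalgebra.comul (R := K) (Φ x))) = _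
      induction Coalgebra.comul (R := K) (Φ x) with
      | zero => simp
      | add y z hy hz => simp only [map_add, hy, hz]
      | tmul p q => simp [transportComul_apply]
  · intro x
    have h : (transportCounit Φ).toLinearMap.rTensor B (transportComul Φ x) =
        Φ.symm.toLinearMap.lTensor K
          (Coalgebra.counit.rTensor A (Coalgebra.comul (R := K) (Φ x))) := by
      rw [transportComul_apply]
      induction Coalgebra.comul (R := K) (Φ x) with
      | zero => simp
      | add y z hy hz => simp only [map_add, hy, hz]
      | tmul p q => simp [transportCounit_apply]
    rw [h, Coalgebra.rTensor_counit_comul]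
    simp
  · intro x
    have h : (transportCounit Φ).toLinearMap.lTensor B (transportComul Φ x) =
        Φ.symm.toLinearMap.rTensor K
          (Coalgebra.counit.lTensor A (Coalgebra.comul (R := K) (Φ x))) := by
      rw [transportComul_apply]
      induction Coalgebra.comul (R := K) (Φ x) with
      | zero => simp
      | add y z hy hz => simp only [map_add, hy, hz]
      | tmul p q => simp [transportCounit_apply]
    rw [h, Coalgebra.lTensor_counit_comul]
    simp
  · intro x
    have h : LinearMap.mul' K B
        ((transportAntipode Φ).toLinearMap.rTensor B (transportComul Φ x)) =
        Φ.symm (LinearMap.mul' K A ((HopfAlgebra.antipode K).rTensor A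
          (Coalgebra.comul (R := K) (Φ x)))) := by
      rw [transportComul_apply]
      induction Coalgebra.comul (R := K) (Φ x) with
      | zero => simp
      | add y z hy hz => simp only [map_add, hy, hz]
      | tmul p q => simp [transportAntipode_apply]
    rw [h, HopfAlgebra.mul_antipode_rTensor_comul_apply, AlgEquiv.commutes, transportCounit_apply]
  · intro x
    have h : LinearMap.mul' K B
        ((transportAntipode Φ).toLinearMap.lTensor B (transportComul Φ x)) =
        Φ.symm (LinearMap.mul' K A ((HopfAlgebra.antipode K).lTensor A
          (Coalgebra.comul (R := K) (Φ x)))) := by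
      rw [transportComul_apply]
      induction Coalgebra.comul (R := K) (Φ x) with
      | zero => simp
      | add y z hy hz => simp only [map_add, hy, hz]
      | tmul p q => simp [transportAntipode_apply]
    rw [h, HopfAlgebra.mul_antipode_lTensor_comul_apply, AlgEquiv.commutes, transportCounit_apply]

end Transport

/-- `Φ` intertwines all iterates of the derivations, so it carries a generating family of
derivatives to one. -/
lemma FinitelyDiffGenerated.of_algEquiv {K : Type u} {A : Type v} {B : Type w} [Field K]
    [CommRing A] [Algebra K A] [Differential A] [CommRing B] [Algebra K B] [Differential B]
    (hA : FinitelyDiffGenerated K A) (Φ : A ≃ₐ[K] B) (hΦ : ∀ x, Φ (x′) = (Φ x)′) :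
    FinitelyDiffGenerated K B := by
  classical
  obtain ⟨s, hs⟩ := hA
  have h : ∀ (n : ℕ) (x : A), Φ ((fun y : A => y′)^[n] x) = (fun y : B => y′)^[n] (Φ x) :=
    fun n x => Function.Semiconj.iterate_right (f := Φ) hΦ n x
  refine ⟨s.image Φ, ?_⟩
  have h1 := congrArg (Subalgebra.map Φ.toAlgHom) hs
  rw [AlgHom.map_adjoin, Algebra.map_top, (AlgHom.range_eq_top _).2 Φ.surjective] at h1
  rw [← h1]
  congr 1
  ext y
  constructor
  · rintro ⟨b, hb, n, rfl⟩
    obtain ⟨x, hx, rfl⟩ := Finset.mem_image.1 hb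
    exact ⟨_, ⟨x, hx, n, rfl⟩, h n x⟩
  · rintro ⟨_, ⟨x, hx, n, rfl⟩, rfl⟩
    exact ⟨Φ x, Finset.mem_image_of_mem _ hx, n, h n x⟩

end DiffTannaka

end

/-! ### The differential Hopf algebra $\mathcal A$ -/

theorem mainTheorem3 {K : Type u} {A : Type v} [Field K] [CharZero K] [Differential K]
    [CommRing A] [HopfAlgebra K A] [Differential A] [DifferentialAlgebra K A]
    [DifferentialHopfAlgebra K A] (hA : FinitelyDiffGenerated K A) :
    ∃ (Δ : Recon K A →ₐ[K] Recon K A ⊗[K] Recon K A) (ε : Recon K A →ₐ[K] K)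
      (S : Recon K A →ₐ[K] Recon K A),
      (∀ (V : DiffRep K A) (n : ℕ) (b : Module.Basis (Fin n) K V) (x : V) (f : Module.Dual K V),
        Δ (Recon.a V (x ⊗ₜ[K] f)) =
          ∑ i, Recon.a V (b i ⊗ₜ[K] f) ⊗ₜ[K] Recon.a V (x ⊗ₜ[K] b.coord i)) ∧
      (∀ (V : DiffRep K A) (x : V) (f : Module.Dual K V), ε (Recon.a V (x ⊗ₜ[K] f)) = f x) ∧
      (∀ (V : DiffRep K A) (x : V) (f : Module.Dual K V),
        S (Recon.a V (x ⊗ₜ[K] f)) = Recon.a V.dual (f ⊗ₜ[K] Module.Dual.eval K V x)) ∧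
      IsDifferentialHopf Δ ε S ∧
      FinitelyDiffGenerated K (Recon K A) ∧
      ∃ Φ : Recon K A ≃ₐ[K] A,
        (∀ (V : DiffRep K A) (x : V) (f : Module.Dual K V), Φ (Recon.a V (x ⊗ₜ[K] f)) = psi V x f) ∧
        (∀ x, Φ (x′) = Differential.deriv (Φ x)) ∧
        (∀ x, TensorProduct.map Φ.toLinearMap Φ.toLinearMap (Δ x) =
          Coalgebra.comul (R := K) (Φ x)) ∧
        (∀ x, ε x = Coalgebra.counit (R := K) (Φ x)) ∧
        (∀ x, Φ (S x) = HopfAlgebra.antipode K (Φ x)) := by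
  have hΦ := Recon.equivCoord_deriv (K := K) (A := A)
  refine ⟨transportComul Recon.equivCoord, transportCounit Recon.equivCoord,
    transportAntipode Recon.equivCoord, fun V n b x f => ?_, fun V x f => ?_, fun V x f => ?_,
    isDifferentialHopf_transport _ hΦ,
    hA.of_algEquiv Recon.equivCoord.symm fun x => ?_, Recon.equivCoord, Recon.equivCoord_a, hΦ,
    map_transportComul _, fun x => rfl, fun x => ?_⟩
  -- After `comul_psi`, each coefficient is rewritten as the image of a class, so that
  -- $\Phi^{-1}\otimes\Phi^{-1}$ cancels; the basis is arbitrary because `comul_psi` holds for every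
  -- basis.
  · rw [transportComul_apply, Recon.equivCoord_a, comul_psi V b]
    simp only [map_sum, TensorProduct.map_tmul, AlgEquiv.toLinearMap_apply,
      ← Recon.equivCoord_a, AlgEquiv.symm_apply_apply]
  · rw [transportCounit_apply, Recon.equivCoord_a, counit_psi]
  -- Since $\Phi$ is injective, the identity may be checked on coefficients, where it is `psi_dual`.
  · rw [transportAntipode_apply, AlgEquiv.symm_apply_eq, Recon.equivCoord_a,
      Recon.equivCoord_a, psi_dual]
  · rw [AlgEquiv.symm_apply_eq, hΦ, AlgEquiv.apply_symm_apply]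
  · rw [transportAntipode_apply, AlgEquiv.apply_symm_apply]
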